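/- **Setting.** Let $n\in\{2,3\}$ and let $\Omega\subset\mathbb R^n$ be open, bounded and convex (for instance with $C^{1,1}$ or polygonal boundary; no boundary regularity is needed). Let $a_{ij},c_0\in L^\infty(\Omega)$ with $c_0\ge 0$, $a_{ij}=a_{ji}$ and $\sum_{i,j}a_{ij}(x)\xi_i\xi_j\ge\theta|\xi|^2$ for some $\theta>0$, almost all $x\in\Omega$ and all $\xi\in\mathbb R^n$, and put $a(y,v)=\int_\Omega\big(\sum_{i,j}a_{ij}\,\partial_iy\,\partial_jv+c_0yv\big)\,dx$ on $H^1_0(\Omega)$. Let $\mathcal S:H^{-1}(\Omega)\to H^1_0(\Omega)$ be the solution operator, $a(\mathcal SF,v)=\langle F,v\rangle$ for all $v\in H_0^1(\Omega)$, and $\mathcal S^*:H^{-1}(\Omega)\to H^1_0(\Omega)$ its adjoint. Let $y_c,y_d\in L^2(\Omega)$, $\alpha,\beta>0$, $-\infty<a<0<b<\infty$, and $U_{ad}=\{v\in L^2(\Omega): a\le v\le b\text{ a.e.}\}$. Consider $$\min_{u,z\in L^2(\Omega)} f(u)+g(z)\quad\text{s.t. } u=z,$$ $$f(u)=\tfrac12\|\mathcal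 S(u+y_c)-y_d\|_{L^2}^2+\tfrac\alpha4\|u\|_{L^2}^2,\qquad g(z)=\tfrac\alpha4\|z\|_{L^2}^2+\beta\|z\|_{L^1}+\delta_{U_{ad}}(z),$$ where $\delta_{U_{ad}}$ is the indicator function ($0$ on $U_{ad}$, $+\infty$ elsewhere), with the augmented Lagrangian $\mathcal L_\sigma(u,z;\lambda)=f(u)+g(z)+\langle\lambda,u-z\rangle_{L^2}+\frac\sigma2\|u-z\|_{L^2}^2$ and the KKT residual $$R(u,z,\lambda)=\|\nabla f(u)+\lambda\|_{L^2}^2+\operatorname{dist}^2(0,-\lambda+\partial g(z))+\|u-z\|_{L^2}^2 .$$ **Inexact ADMM.** Let $\sigma>0$, $\tau\in(0,\frac{1+\sqrt5}{2})$, $\epsilon_k\ge0$ with $\sum_{k\ge0}\epsilon_k<\infty$, and $(u^0,z^0,\lambda^0)\in L^2(\Omega)\times U_{ad}\times L^2(\Omega)$. For $k\ge0$, $$u^{k+1}=\arg\min_u\ \mathcal L_\sigma(u,z^k;\lambda^k)-\langle\delta^k,u\rangle_{L^2}\ \text{ for some }\delta^k\in L^2(\Omega)\text{ with }\|\delta^k\|_{L^2}\le\epsilon_k,$$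 $$z^{k+1}=\arg\min_z\ \mathcal L_\sigma(u^{k+1},z;\lambda^k),\qquad \lambda^{k+1}=\lambda^k+\tau\sigma(u^{k+1}-z^{k+1}).$$ The associated states and adjoint states are $y^k=\mathcal S(u^k+y_c)$ and $p^k=\mathcal S^*(y_d-y^k)$. **Theorem.** Let $(y^*,u^*,z^*,p^*,\lambda^*)$ be a KKT point, i.e. $y^*=\mathcal S(u^*+y_c)$, $p^*=\mathcal S^*(y_d-y^*)$, $\frac\alpha2u^*-p^*+\lambda^*=0$, $u^*=z^*\in U_{ad}$, and $\langle\frac\alpha2z^*-\lambda^*,\tilde z-z^*\rangle_{L^2}+\beta(\|\tilde z\|_{L^1}-\|z^*\|_{L^1})\ge0$ for all $\tilde z\in U_{ad}$. Then every sequence generated by the inexact ADMM satisfies $$\lim_{k\to\infty}\big\{\|u^k-u^*\|_{L^2}+\|z^k-z^*\|_{L^2}+\|\lambda^k-\lambda^*\|_{L^2}\big\}=0,\qquad \lim_{k\to\infty}\big\{\|y^k-y^*\|_{H^1_0}+\|p^k-p^*\|_{H^1_0}\big\}=0 .$$ Moreover, for given $\Omega$ and given algorithm parameters $\sigma,\tau,(\epsilon_k)$,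 there is a constant $C$ depending only on the initial point $(u^0,z^0,\lambda^0)$ and the optimal solution $(u^*,z^*,\lambda^*)$ such that for all $k\ge1$ $$\min_{1\le i\le k}R(u^i,z^i,\lambda^i)\le\frac Ck,\qquad\text{and}\qquad \lim_{k\to\infty}\Big(k\cdot\min_{1\le i\le k}R(u^i,z^i,\lambda^i)\Big)=0 .$$ -/

import Mathlib

open MeasureTheory Set Filter Topology
open scoped ENNReal ContDiff

noncomputable section

namespace SparseControl

/-- The Euclidean space `ℝⁿ`. -/
abbrev E (n : ℕ) : Type := EuclideanSpace ℝ (Fin n)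

/-- `L²(Ω)`. -/
abbrev L2 {n : ℕ} (Ω : Set (E n)) : Type := Lp ℝ 2 (volume.restrict Ω)

/-- `L²(Ω; ℝⁿ)`. -/
abbrev L2Vec {n : ℕ} (Ω : Set (E n)) : Type := Lp (E n) 2 (volume.restrict Ω)

/-- The space of pairs (function, gradient) in `L²(Ω) × L²(Ω; ℝⁿ)`, with the norm
`(‖y‖² + ‖G‖²)^(1/2)`, i.e. the `H¹` norm. -/
abbrev Pair {n : ℕ} (Ω : Set (E n)) : Type := WithLp 2 (L2 Ω × L2Vec Ω)

/-- The pairs `(φ, ∇φ)` with `φ ∈ C_c^∞(Ω)`. -/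
def testPairs {n : ℕ} (Ω : Set (E n)) : Submodule ℝ (Pair Ω) where
  carrier := {w | ∃ φ : E n → ℝ, ContDiff ℝ ∞ φ ∧ HasCompactSupport φ ∧ tsupport φ ⊆ Ω ∧
    w.fst =ᵐ[volume.restrict Ω] φ ∧ w.snd =ᵐ[volume.restrict Ω] gradient φ}
  zero_mem' := by
    refine ⟨0, contDiff_const, HasCompactSupport.zero, by simp, ?_, ?_⟩
    · exact Lp.coeFn_zero _ _ _
    · have h : gradient (0 : E n → ℝ) = 0 := by
        funext x; simp [gradient]
      rw [h]; exact Lp.coeFn_zero _ _ _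
  add_mem' := by
    rintro v w ⟨φ, h1, h2, h3, h4, h5⟩ ⟨ψ, k1, k2, k3, k4, k5⟩
    refine ⟨φ + ψ, h1.add k1, h2.add k2,
      (tsupport_add φ ψ).trans (union_subset h3 k3), ?_, ?_⟩
    · exact (Lp.coeFn_add v.fst w.fst).trans (h4.add k4)
    · have h : gradient (φ + ψ) = gradient φ + gradient ψ := by
        funext x
        simp [gradient, fderiv_add (h1.differentiable (by simp) x)
          (k1.differentiable (by simp) x)]
      rw [h]; exact (Lp.coeFn_add v.snd w.snd).trans (h5.add k5)
  smul_mem' := by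
    rintro c w ⟨φ, h1, h2, h3, h4, h5⟩
    refine ⟨c • φ, contDiff_const.smul h1, h2.smul_left,
      (closure_mono (Function.support_const_smul_subset c φ)).trans h3, ?_, ?_⟩
    · exact (Lp.coeFn_smul c w.fst).trans (h4.const_smul c)
    · have h : gradient (c • φ) = c • gradient φ := by
        funext x
        simp [gradient, fderiv_const_smul (h1.differentiable (by simp) x)]
      rw [h]; exact (Lp.coeFn_smul c w.snd).trans (h5.const_smul c)

/-- `H¹₀(Ω)`: the closure of `C_c^∞(Ω)` in the `H¹` norm. An element is recorded as the pair
`(y, ∇y)` of an `L²` function and its weak gradient; the norm is the `H¹` norm. -/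
def H10Sub {n : ℕ} (Ω : Set (E n)) : Submodule ℝ (Pair Ω) := (testPairs Ω).topologicalClosure

abbrev H10 {n : ℕ} (Ω : Set (E n)) : Type := H10Sub Ω

/-- `H⁻¹(Ω)`, the topological dual of `H¹₀(Ω)`. -/
abbrev Hm1 {n : ℕ} (Ω : Set (E n)) : Type := StrongDual ℝ (H10 Ω)

/-- The embedding `H¹₀(Ω) → L²(Ω)`. -/
def toL2 {n : ℕ} {Ω : Set (E n)} : H10 Ω →L[ℝ] L2 Ω :=
  (WithLp.fstL 2 ℝ (L2 Ω) (L2Vec Ω)).comp (H10Sub Ω).subtypeL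

/-- The weak gradient of an element of `H¹₀(Ω)`. -/
def grad {n : ℕ} {Ω : Set (E n)} : H10 Ω →L[ℝ] L2Vec Ω :=
  (WithLp.sndL 2 ℝ (L2 Ω) (L2Vec Ω)).comp (H10Sub Ω).subtypeL

/-- The embedding `L²(Ω) → H⁻¹(Ω)`, `w ↦ (v ↦ (w, v)_{L²(Ω)})`. -/
def toHm1 {n : ℕ} {Ω : Set (E n)} (w : L2 Ω) : Hm1 Ω := (innerSL ℝ w).comp toL2

/-- The data of the control problem: the coefficients `a_{ij}`, `c₀` of the operator
`A y = -∑ ∂_j (a_{ij} ∂_i y) + c₀ y`, the functions `y_c`, `y_d ∈ L²(Ω)`, the cost parameters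
`α`, `β` and the control bounds `a = lo`, `b = hi`. -/
structure Problem {n : ℕ} (Ω : Set (E n)) where
  A : Fin n → Fin n → E n → ℝ
  c₀ : E n → ℝ
  yc : L2 Ω
  yd : L2 Ω
  α : ℝ
  β : ℝ
  lo : ℝ
  hi : ℝ

namespace Problem

variable {n : ℕ} {Ω : Set (E n)}

/-- The standing assumptions on the data: bounded coefficients, `c₀ ≥ 0`, symmetry and uniform
ellipticity, and `α, β > 0`, `a < 0 < b`. -/
structure Admissible (P : Problem Ω) : Prop where
  A_bdd : ∀ i j, MemLp (P.A i j) ⊤ (volume.restrict Ω)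
  c₀_bdd : MemLp P.c₀ ⊤ (volume.restrict Ω)
  c₀_nonneg : ∀ᵐ x ∂(volume.restrict Ω), 0 ≤ P.c₀ x
  A_symm : ∀ᵐ x ∂(volume.restrict Ω), ∀ i j, P.A i j x = P.A j i x
  A_elliptic : ∃ θ : ℝ, 0 < θ ∧ ∀ᵐ x ∂(volume.restrict Ω), ∀ ξ : E n,
    θ * ‖ξ‖ ^ 2 ≤ ∑ i, ∑ j, P.A i j x * ξ i * ξ j
  α_pos : 0 < P.α
  β_pos : 0 < P.β
  lo_neg : P.lo < 0
  hi_pos : 0 < P.hi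

/-- The bilinear form of `A`: `∫_Ω (∑_{i,j} a_{ij} ∂_i y ∂_j v + c₀ y v) dx`. -/
def form (P : Problem Ω) (y v : H10 Ω) : ℝ :=
  ∫ x in Ω, ((∑ i, ∑ j, P.A i j x * grad y x i * grad v x j) + P.c₀ x * toL2 y x * toL2 v x)

/-- The solution operator `S : H⁻¹(Ω) → H¹₀(Ω)`: `S F` is the weak solution `y` of `A y = F`,
`y = 0` on `∂Ω`, i.e. the `y ∈ H¹₀(Ω)` with `a(y, v) = F v` for all `v ∈ H¹₀(Ω)`. -/
def S (P : Problem Ω) (F : Hm1 Ω) : H10 Ω :=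
  Classical.epsilon fun y => ∀ v, P.form y v = F v

/-- The adjoint `S* : H⁻¹(Ω) → H¹₀(Ω)` (using reflexivity of `H¹₀(Ω)`): `S* F` is the
`p ∈ H¹₀(Ω)` with `⟨G, p⟩ = ⟨F, S G⟩` for all `G ∈ H⁻¹(Ω)`. -/
def Sadj (P : Problem Ω) (F : Hm1 Ω) : H10 Ω :=
  Classical.epsilon fun p => ∀ G : Hm1 Ω, G p = F (P.S G)

/-- The state `y(u) = S (u + y_c)`. -/
def state (P : Problem Ω) (u : L2 Ω) : H10 Ω := P.S (toHm1 (u + P.yc))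

/-- The adjoint state `S* (y_d - y)`. -/
def adjState (P : Problem Ω) (y : H10 Ω) : H10 Ω := P.Sadj (toHm1 (P.yd - toL2 y))

/-- The admissible set `{v ∈ L²(Ω) | a ≤ v ≤ b a.e. on Ω}`. -/
def Uad (P : Problem Ω) : Set (L2 Ω) :=
  {v | ∀ᵐ x ∂(volume.restrict Ω), P.lo ≤ v x ∧ v x ≤ P.hi}

end Problem

/-- The `L¹(Ω)` norm of an `L²(Ω)` function (`Ω` bounded). -/
def normL1 {n : ℕ} {Ω : Set (E n)} (z : L2 Ω) : ℝ := ∫ x in Ω, |z x|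

namespace Problem

variable {n : ℕ} {Ω : Set (E n)}

/-- The smooth part of the reduced cost. -/
def f (P : Problem Ω) (u : L2 Ω) : ℝ :=
  1 / 2 * ‖toL2 (P.state u) - P.yd‖ ^ 2 + P.α / 4 * ‖u‖ ^ 2

open Classical in
/-- The nonsmooth part, with the indicator function of `Uad`. -/
def g (P : Problem Ω) (z : L2 Ω) : EReal :=
  ((P.α / 4 * ‖z‖ ^ 2 + P.β * normL1 z : ℝ) : EReal) + (if z ∈ P.Uad then 0 else ⊤)

/-- The augmented Lagrangian. -/
def augLag (P : Problem Ω) (σ : ℝ) (u z lam : L2 Ω) : EReal :=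
  (P.f u : EReal) + P.g z + ((inner ℝ lam (u - z) + σ / 2 * ‖u - z‖ ^ 2 : ℝ) : EReal)

/-- The convex subdifferential of `g` in `L²(Ω)`. -/
def subdiffG (P : Problem Ω) (z : L2 Ω) : Set (L2 Ω) :=
  {ξ | ∀ w, P.g z + ((inner ℝ ξ (w - z) : ℝ) : EReal) ≤ P.g w}

/-- The KKT residual
`‖∇f(u) + λ‖² + dist²(0, -λ + ∂g(z)) + ‖u - z‖²`, with values in `[0, ∞]`
(it is `∞` when `∂g(z)` is empty). -/
def R (P : Problem Ω) (u z lam : L2 Ω) : ℝ≥0∞ :=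
  ‖gradient P.f u + lam‖ₑ ^ 2
    + Metric.infEDist 0 ((fun ξ => -lam + ξ) '' P.subdiffG z) ^ 2
    + ‖u - z‖ₑ ^ 2

/-- The KKT system of the problem. -/
structure IsKKT (P : Problem Ω) (y : H10 Ω) (u z : L2 Ω) (p : H10 Ω) (lam : L2 Ω) : Prop where
  state_eq : y = P.state u
  adj_eq : p = P.adjState y
  grad_eq : (P.α / 2) • u - toL2 p + lam = 0
  u_eq_z : u = z
  z_mem : z ∈ P.Uad
  var_ineq : ∀ w ∈ P.Uad,
    0 ≤ inner ℝ ((P.α / 2) • z - lam) (w - z) + P.β * (normL1 w - normL1 z)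

/-- `(u^k, z^k, λ^k)` is generated by the inexact ADMM with penalty parameter `σ`, step length `τ`
and error tolerances `ε_k`. -/
structure IsADMM (P : Problem Ω) (σ τ : ℝ) (ε : ℕ → ℝ) (u z lam : ℕ → L2 Ω) : Prop where
  z_init : z 0 ∈ P.Uad
  u_step : ∀ k, ∃ δ : L2 Ω, ‖δ‖ ≤ ε k ∧
    IsMinOn (fun v => P.augLag σ v (z k) (lam k) - ((inner ℝ δ v : ℝ) : EReal)) univ (u (k + 1))
  z_step : ∀ k, IsMinOn (fun w => P.augLag σ (u (k + 1)) w (lam k)) univ (z (k + 1))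
  lam_step : ∀ k, lam (k + 1) = lam k + (τ * σ) • (u (k + 1) - z (k + 1))

end Problem

end SparseControl

end

open SparseControl

/-! Convergence is a Hilbert space argument that uses only monotonicity. `∇f` is `α/2`-strongly
monotone, since the quadratic tracking term contributes a positive semidefinite operator, and `∂g`
is monotone. Subtracting the KKT conditions from the optimality conditions of the two subproblems
gives the inequalities of `ErrorRecursion` for the errors `U`, `Z`, `L`.

Testing them with the errors yields `energy_step`: the energy `‖L‖²/(2τσ) + σ‖Z‖²/2` decreases up to
`⟨δ, U⟩` and a quadratic form in the residual `r = U - Z` and the increment `d` of `Z`. Monotonicity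
of `∂g` between consecutive iterates replaces the cross term by one in the previous residual. Below
the golden ratio, Young's inequality makes the form positive modulo a telescoping multiple of `‖r‖²`
(`exists_weights`). The inexactness is absorbed by a Gronwall argument for square roots of energies
(`sum_le_of_perturbed_descent`). Hence `‖r‖²`, `‖d‖²` and `μ‖U‖²` are summable, with a bound
independent of `μ` (`ErrorRecursion.exists_sum_bound`).

Everything follows from this sum. Its terms tend to zero, so `u`, then `z`, then `λ` (through the
`u`-equation) converge, as do the states and adjoint states by continuity of the solution operator.
The residual `R` is dominated by `ε² + ‖r‖² + ‖d‖²` (`IsADMM.R_le`), so its running minimum is both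
`O(1/k)` and `o(1/k)`. The PDE enters only through Lax–Milgram and the symmetry `S* = S`. -/

namespace SparseControl

/-! ### Abstract inexact ADMM: energy estimate and summability. -/

section ADMM

variable {H : Type*} [NormedAddCommGroup H] [InnerProductSpace ℝ H]

/-- The relations satisfied by the errors `U = u - u*`, `Z = z - z*`, `L = λ - λ*` of an inexact
ADMM sequence when `∇f` is `μ`-strongly monotone and `∂g` is monotone. -/
structure ErrorRecursion (μ σ τ : ℝ) (ε : ℕ → ℝ) (U Z L δ : ℕ → H) : Prop where
  norm_le : ∀ k, ‖δ k‖ ≤ ε k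
  grad_mono : ∀ k, μ * ‖U (k + 1)‖ ^ 2 ≤
    inner ℝ (δ k - L k - σ • (U (k + 1) - Z k)) (U (k + 1))
  subdiff_mono : ∀ k, 0 ≤ inner ℝ (L k + σ • (U (k + 1) - Z (k + 1))) (Z (k + 1))
  subdiff_mono_succ : ∀ k, 0 ≤ inner ℝ ((L (k + 1) + σ • (U (k + 2) - Z (k + 2))) -
    (L k + σ • (U (k + 1) - Z (k + 1)))) (Z (k + 2) - Z (k + 1))
  mult_step : ∀ k, L (k + 1) = L k + (τ * σ) • (U (k + 1) - Z (k + 1))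

/-- The energy estimate for one ADMM step. -/
theorem energy_step {μ σ τ : ℝ} (hσ : 0 < σ) (hτ : 0 < τ) {z d r l δ : H}
    (h₁ : μ * ‖z + d + r‖ ^ 2 ≤ inner ℝ (δ - l - σ • (d + r)) (z + d + r))
    (h₂ : 0 ≤ inner ℝ (l + σ • r) (z + d)) :
    ‖l + (τ * σ) • r‖ ^ 2 / (2 * τ * σ) + σ / 2 * ‖z + d‖ ^ 2 + μ * ‖z + d + r‖ ^ 2
      + σ / 2 * ((2 - τ) * ‖r‖ ^ 2 + ‖d‖ ^ 2 + 2 * inner ℝ d r)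
    ≤ ‖l‖ ^ 2 / (2 * τ * σ) + σ / 2 * ‖z‖ ^ 2 + inner ℝ δ (z + d + r) := by
  have e₁ : ‖l + (τ * σ) • r‖ ^ 2 / (2 * τ * σ)
      = ‖l‖ ^ 2 / (2 * τ * σ) + inner ℝ l r + τ * σ / 2 * ‖r‖ ^ 2 := by
    rw [norm_add_sq_real, inner_smul_right, norm_smul, Real.norm_of_nonneg (by positivity)]
    field_simp
  have e₂ : ‖z + d‖ ^ 2 = ‖z‖ ^ 2 + 2 * inner ℝ z d + ‖d‖ ^ 2 := norm_add_sq_real _ _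
  have c₁ := real_inner_comm z d
  have c₂ := real_inner_comm z r
  have c₃ := real_inner_comm d r
  simp only [inner_add_left, inner_add_right, inner_sub_left, real_inner_smul_left,
    real_inner_self_eq_norm_sq] at h₁ h₂ ⊢
  rw [e₁, e₂]
  rw [c₁, c₂, c₃] at *
  nlinarith

/-- For step lengths below the golden ratio the quadratic form arising in the energy estimate is
bounded below up to a telescoping term. -/
theorem exists_weights {τ : ℝ} (hτ : 0 < τ) (hτ' : τ < (1 + √5) / 2) :
    ∃ A η : ℝ, 0 ≤ A ∧ 0 < η ∧ ∀ r' r d : H,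
      A * (‖r'‖ ^ 2 - ‖r‖ ^ 2) + η * (‖r'‖ ^ 2 + ‖d‖ ^ 2) ≤
        (2 - τ) * ‖r'‖ ^ 2 + ‖d‖ ^ 2 + 2 * ((1 - τ) * inner ℝ r d) := by
  have h5 : √5 ^ 2 = 5 := Real.sq_sqrt (by norm_num)
  have h5' : 0 ≤ √5 := Real.sqrt_nonneg 5
  have hgold : τ ^ 2 - τ - 1 < 0 := by
    have : τ - (1 + √5) / 2 < 0 := by linarith
    have h' : 0 < τ - (1 - √5) / 2 := by nlinarith
    nlinarith [mul_neg_of_neg_of_pos this h']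
  have hs0 : 0 ≤ |τ - 1| := abs_nonneg _
  have hs2 : |τ - 1| ^ 2 = (τ - 1) ^ 2 := sq_abs _
  have hab : |τ - 1| = |1 - τ| := abs_sub_comm _ _
  generalize |τ - 1| = s at *
  -- With `s = |τ - 1|` this is exactly `τ² - τ - 1 < 0`, the golden ratio condition.
  have hs : s ^ 2 < 2 - τ := by nlinarith
  have ht : 0 < 2 - τ := by nlinarith [sq_nonneg s]
  -- The Young parameter must lie strictly between `s / (2 - τ)` and `1 / s`; their mediant does,
  -- and it still makes sense for `s = 0`.
  set c := (1 + s) / (2 - τ + s) with hc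
  have hc0 : 0 < c := by positivity
  have h₁ : s * c < 1 := by rw [hc, mul_div_assoc', div_lt_one (by positivity)]; nlinarith
  have h₂ : s / c < 2 - τ := by
    rw [div_lt_iff₀ hc0, hc, mul_div_assoc', lt_div_iff₀ (by positivity)]; nlinarith
  refine ⟨s / c, min (2 - τ - s / c) (1 - s * c), by positivity,
    lt_min (by linarith) (by linarith), fun r' r d => ?_⟩
  have hi : -(s * (‖r‖ * ‖d‖)) ≤ (1 - τ) * inner ℝ r d := by
    have h := abs_real_inner_le_norm r d
    have : |(1 - τ) * inner ℝ r d| ≤ s * (‖r‖ * ‖d‖) := by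
      rw [abs_mul, ← hab]; gcongr
    exact (abs_le.mp this).1
  have hy : 2 * (s * (‖r‖ * ‖d‖)) ≤ s / c * ‖r‖ ^ 2 + s * c * ‖d‖ ^ 2 := by
    have : 0 ≤ s / c * (‖r‖ - c * ‖d‖) ^ 2 := by positivity
    have e : s / c * (‖r‖ - c * ‖d‖) ^ 2
        = s / c * ‖r‖ ^ 2 + s * c * ‖d‖ ^ 2 - 2 * (s * (‖r‖ * ‖d‖)) := by
      field_simp; ring
    linarith
  have m₁ := mul_le_mul_of_nonneg_right (min_le_left (2 - τ - s / c) (1 - s * c))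
    (sq_nonneg ‖r'‖)
  have m₂ := mul_le_mul_of_nonneg_right (min_le_right (2 - τ - s / c) (1 - s * c))
    (sq_nonneg ‖d‖)
  nlinarith

/-- A discrete Gronwall argument for energies that are perturbed by a multiple of their square
root. -/
theorem sum_le_of_perturbed_descent {K T Ψ₀ : ℝ} (hK : 0 ≤ K) {e Ψ D : ℕ → ℝ}
    (hΨ : ∀ k, 0 ≤ Ψ k) (hD : ∀ k, 0 ≤ D k) (he : ∀ k, 0 ≤ e k)
    (hT : ∀ N, ∑ k ∈ Finset.range N, e k ≤ T) (h0 : Ψ 0 ≤ Ψ₀)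
    (h : ∀ k, Ψ (k + 1) + D k ≤ Ψ k + e k * (K * √(Ψ (k + 1) + D k))) (N : ℕ) :
    ∑ k ∈ Finset.range N, D k ≤ Ψ₀ + T * (K * (√Ψ₀ + K * T)) := by
  -- From `s² ≤ p² + K e s` one gets `s ≤ p + K e`: square roots of energies grow only additively.
  have step : ∀ k, √(Ψ (k + 1) + D k) ≤ √(Ψ k) + K * e k := by
    intro k
    have hX : 0 ≤ Ψ (k + 1) + D k := add_nonneg (hΨ _) (hD _)
    have hs := Real.sq_sqrt hX
    have hp := Real.sq_sqrt (hΨ k)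
    have h' := h k
    have s0 := Real.sqrt_nonneg (Ψ (k + 1) + D k)
    have p0 := Real.sqrt_nonneg (Ψ k)
    have hKe := mul_nonneg hK (he k)
    by_contra! hc
    nlinarith
  have bound : ∀ k, √(Ψ k) ≤ √Ψ₀ + K * ∑ i ∈ Finset.range k, e i := by
    intro k
    induction k with
    | zero => simpa using Real.sqrt_le_sqrt h0
    | succ k ih =>
      rw [Finset.sum_range_succ]
      have : √(Ψ (k + 1)) ≤ √(Ψ (k + 1) + D k) := Real.sqrt_le_sqrt (by linarith [hD k])
      linarith [step k]
  have bound' : ∀ k, √(Ψ (k + 1) + D k) ≤ √Ψ₀ + K * T := by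
    intro k
    have h₁ := mul_le_mul_of_nonneg_left (hT (k + 1)) hK
    rw [Finset.sum_range_succ] at h₁
    linarith [step k, bound k]
  have tele : ∀ N, Ψ N + ∑ k ∈ Finset.range N, D k ≤
      Ψ₀ + (∑ k ∈ Finset.range N, e k) * (K * (√Ψ₀ + K * T)) := by
    intro N
    induction N with
    | zero => simpa using h0
    | succ N ih =>
      rw [Finset.sum_range_succ, Finset.sum_range_succ]
      have := mul_le_mul_of_nonneg_left (mul_le_mul_of_nonneg_left (bound' N) hK) (he N)
      linarith [h N]
  have hB : 0 ≤ K * (√Ψ₀ + K * T) :=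
    mul_nonneg hK ((Real.sqrt_nonneg _).trans (bound' 0))
  linarith [tele N, hΨ N, mul_le_mul_of_nonneg_right (hT N) hB]

/-- The first ADMM iterate is bounded in terms of the initial errors. -/
theorem first_step_bound {μ σ τ : ℝ} (hμ : 0 ≤ μ) (hσ : 0 < σ) {ε : ℕ → ℝ}
    {U Z L δ : ℕ → H} (h : ErrorRecursion μ σ τ ε U Z L δ) :
    ‖U 1‖ + ‖Z 1‖ ≤ 4 * (σ * ‖Z 0‖ + ε 0 + ‖L 0‖) / σ := by
  have h₁ := (mul_nonneg hμ (sq_nonneg _)).trans (h.grad_mono 0)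
  have h₂ := h.subdiff_mono 0
  have hε : 0 ≤ ε 0 := (norm_nonneg _).trans (h.norm_le 0)
  simp only [zero_add, inner_add_left, inner_sub_left, real_inner_smul_left,
    real_inner_self_eq_norm_sq] at h₁ h₂
  have b₁ := (real_inner_le_norm (δ 0) (U 1)).trans
    (mul_le_mul_of_nonneg_right (h.norm_le 0) (norm_nonneg _))
  have b₂ := (abs_le.mp (abs_real_inner_le_norm (L 0) (U 1))).1
  have b₃ := real_inner_le_norm (L 0) (Z 1)
  have b₄ := real_inner_le_norm (Z 0) (U 1)
  have b₅ := real_inner_le_norm (U 1) (Z 1)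
  rw [le_div_iff₀ hσ]
  set M := σ * ‖Z 0‖ + ε 0 + ‖L 0‖ with hM
  have n₁ := norm_nonneg (U 1)
  have n₂ := norm_nonneg (Z 1)
  have n₃ := norm_nonneg (Z 0)
  have n₄ := norm_nonneg (L 0)
  have hM0 : 0 ≤ M := by positivity
  -- Sum of the two monotonicity inequalities at the first step. The bound then follows from `x² -
  -- xy + y² ≥ (x + y)²/4`.
  have key : σ * (‖U 1‖ ^ 2 - ‖U 1‖ * ‖Z 1‖ + ‖Z 1‖ ^ 2) ≤ M * (‖U 1‖ + ‖Z 1‖) := by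
    have q₁ := mul_le_mul_of_nonneg_left b₄ hσ.le
    have q₂ := mul_le_mul_of_nonneg_left b₅ hσ.le
    have q₃ : 0 ≤ (σ * ‖Z 0‖ + ε 0) * ‖Z 1‖ := by positivity
    nlinarith
  by_contra! hc
  have q : σ * (‖U 1‖ + ‖Z 1‖) ^ 2 ≤ 4 * M * (‖U 1‖ + ‖Z 1‖) := by
    nlinarith [mul_nonneg hσ.le (sq_nonneg (‖U 1‖ - ‖Z 1‖))]
  have hp : 0 < ‖U 1‖ + ‖Z 1‖ := by
    by_contra! h0
    nlinarith
  nlinarith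

/-- The squared primal residuals and successive differences of an inexact ADMM sequence are
summable, with a bound that depends only on the parameters and on the initial errors. -/
theorem ErrorRecursion.exists_sum_bound {σ τ : ℝ} (hσ : 0 < σ) (hτ : 0 < τ)
    (hτ' : τ < (1 + √5) / 2) {ε : ℕ → ℝ} (hε : Summable ε) (b : ℝ) :
    ∃ C : ℝ, ∀ (μ : ℝ), 0 ≤ μ → ∀ U Z L δ : ℕ → H, ErrorRecursion μ σ τ ε U Z L δ →
      ‖Z 0‖ ≤ b → ‖L 0‖ ≤ b → ∀ N,
      ∑ k ∈ Finset.range N, (‖U (k + 1) - Z (k + 1)‖ ^ 2 + ‖Z (k + 1) - Z k‖ ^ 2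
        + μ * ‖U (k + 2)‖ ^ 2) ≤ C := by
  obtain ⟨A, η, hA, hη, hw⟩ := exists_weights (H := H) hτ hτ'
  set m := 4 * (σ * b + ε 0 + b) / σ with hm
  set Ψ₀ := (b + τ * σ * m) ^ 2 / (2 * τ * σ) + σ / 2 * m ^ 2 + σ / 2 * (A * m ^ 2) with hΨ₀
  -- `‖U‖ ≤ ‖Z‖ + ‖r‖`, where the energy controls `Z` and the dissipation controls `r`. The term
  -- `μ‖U‖²` is avoided here, which keeps the final constant free of `μ`.
  set K := √(2 / σ) + √(2 / (σ * η)) with hK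
  have hK0 : 0 ≤ K := by positivity
  set T := ∑' k, ε (k + 1) with hT
  set κ := min 1 (σ / 2 * η) with hκ
  have hκ0 : 0 < κ := by positivity
  set S := (Ψ₀ + T * (K * (√Ψ₀ + K * T))) / κ with hS
  refine ⟨S + (m ^ 2 + (m + b) ^ 2), fun μ hμ U Z L δ h hZ hL N => ?_⟩
  have hε0 : ∀ k, 0 ≤ ε k := fun k => (norm_nonneg _).trans (h.norm_le k)
  have hb : 0 ≤ b := (norm_nonneg _).trans hZ
  have h1 : ‖U 1‖ + ‖Z 1‖ ≤ m := by
    refine (first_step_bound hμ hσ h).trans ?_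
    rw [hm]; gcongr
  have hr1 : ‖U 1 - Z 1‖ ≤ m := (norm_sub_le _ _).trans h1
  have hZ1 : ‖Z 1‖ ≤ m := by linarith [norm_nonneg (U 1)]
  have hd0 : ‖Z 1 - Z 0‖ ≤ m + b := (norm_sub_le _ _).trans (add_le_add hZ1 hZ)
  have hL1 : ‖L 1‖ ≤ b + τ * σ * m := by
    rw [h.mult_step 0]
    refine (norm_add_le _ _).trans (add_le_add hL ?_)
    rw [norm_smul, Real.norm_of_nonneg (by positivity)]
    gcongr
  -- The energy starts at index 1: comparing consecutive subgradients needs two actual `z`-steps,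
  -- and the initial `z` is not the result of one. The first step is covered by `m`.
  let Ψ : ℕ → ℝ := fun k => ‖L (k + 1)‖ ^ 2 / (2 * τ * σ) + σ / 2 * ‖Z (k + 1)‖ ^ 2
    + σ / 2 * (A * ‖U (k + 1) - Z (k + 1)‖ ^ 2)
  let D : ℕ → ℝ := fun k => σ / 2 * (η * (‖U (k + 2) - Z (k + 2)‖ ^ 2
    + ‖Z (k + 2) - Z (k + 1)‖ ^ 2)) + μ * ‖U (k + 2)‖ ^ 2
  have hΨ : ∀ k, 0 ≤ Ψ k := fun k => by positivity
  have hD : ∀ k, 0 ≤ D k := fun k => by positivity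
  have hΨ0 : Ψ 0 ≤ Ψ₀ := by
    simp only [Ψ, hΨ₀, zero_add]
    gcongr
  have hεs : Summable fun k => ε (k + 1) := (summable_nat_add_iff 1).2 hε
  have desc : ∀ k, Ψ (k + 1) + D k ≤ Ψ k + ε (k + 1) * (K * √(Ψ (k + 1) + D k)) := by
    intro k
    have hU : ‖U (k + 2)‖ ≤ K * √(Ψ (k + 1) + D k) := by
      have hz : ‖Z (k + 2)‖ ≤ √(2 / σ) * √(Ψ (k + 1) + D k) := by
        rw [← Real.sqrt_mul (by positivity)]
        refine Real.le_sqrt_of_sq_le ?_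
        have : σ / 2 * ‖Z (k + 2)‖ ^ 2 ≤ Ψ (k + 1) + D k := by
          have : 0 ≤ ‖L (k + 1 + 1)‖ ^ 2 / (2 * τ * σ)
            + σ / 2 * (A * ‖U (k + 1 + 1) - Z (k + 1 + 1)‖ ^ 2) := by positivity
          have := hD k
          simp only [Ψ] at *
          linarith
        calc ‖Z (k + 2)‖ ^ 2 = 2 / σ * (σ / 2 * ‖Z (k + 2)‖ ^ 2) := by field_simp
          _ ≤ _ := by gcongr
      have hr : ‖U (k + 2) - Z (k + 2)‖ ≤ √(2 / (σ * η)) * √(Ψ (k + 1) + D k) := by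
        rw [← Real.sqrt_mul (by positivity)]
        refine Real.le_sqrt_of_sq_le ?_
        have : σ / 2 * η * ‖U (k + 2) - Z (k + 2)‖ ^ 2 ≤ Ψ (k + 1) + D k := by
          have : 0 ≤ σ / 2 * (η * ‖Z (k + 2) - Z (k + 1)‖ ^ 2) + μ * ‖U (k + 2)‖ ^ 2 := by
            positivity
          have := hΨ (k + 1)
          simp only [D] at *
          linarith
        calc ‖U (k + 2) - Z (k + 2)‖ ^ 2
            = 2 / (σ * η) * (σ / 2 * η * ‖U (k + 2) - Z (k + 2)‖ ^ 2) := by field_simp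
          _ ≤ _ := by gcongr
      have : ‖U (k + 2)‖ ≤ ‖Z (k + 2)‖ + ‖U (k + 2) - Z (k + 2)‖ := by
        simpa using norm_add_le (Z (k + 2)) (U (k + 2) - Z (k + 2))
      rw [hK, add_mul]
      linarith
    have hδ : inner ℝ (δ (k + 1)) (U (k + 2)) ≤ ε (k + 1) * (K * √(Ψ (k + 1) + D k)) :=
      (real_inner_le_norm _ _).trans
        (mul_le_mul (h.norm_le _) hU (norm_nonneg _) (hε0 _))
    have e₁ : Z (k + 1) + (Z (k + 2) - Z (k + 1)) = Z (k + 2) := by abel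
    have e₂ : Z (k + 1) + (Z (k + 2) - Z (k + 1)) + (U (k + 2) - Z (k + 2)) = U (k + 2) := by
      abel
    have e₃ : (Z (k + 2) - Z (k + 1)) + (U (k + 2) - Z (k + 2)) = U (k + 2) - Z (k + 1) := by
      abel
    have en := energy_step (μ := μ) (σ := σ) (τ := τ) hσ hτ (z := Z (k + 1))
      (d := Z (k + 2) - Z (k + 1))
      (r := U (k + 2) - Z (k + 2)) (l := L (k + 1)) (δ := δ (k + 1))
      (by rw [e₂, e₃]; exact h.grad_mono (k + 1)) (by rw [e₁]; exact h.subdiff_mono (k + 1))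
    rw [e₂, e₁, ← h.mult_step (k + 1)] at en
    -- By the multiplier update, the difference of consecutive subgradients is `σ (r' - (1 - τ) r)`,
    -- with `r'` the new and `r` the old residual.
    have mono : (1 - τ) * inner ℝ (U (k + 1) - Z (k + 1)) (Z (k + 2) - Z (k + 1)) ≤
        inner ℝ (Z (k + 2) - Z (k + 1)) (U (k + 2) - Z (k + 2)) := by
      have hm := h.subdiff_mono_succ k
      rw [h.mult_step k] at hm
      have e : L k + (τ * σ) • (U (k + 1) - Z (k + 1)) + σ • (U (k + 2) - Z (k + 2)) -
          (L k + σ • (U (k + 1) - Z (k + 1)))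
          = σ • ((U (k + 2) - Z (k + 2)) - (1 - τ) • (U (k + 1) - Z (k + 1))) := by
        module
      rw [e, real_inner_smul_left, inner_sub_left, real_inner_smul_left] at hm
      have := nonneg_of_mul_nonneg_right hm hσ
      rw [real_inner_comm (U (k + 2) - Z (k + 2))]
      linarith
    have hw' := hw (U (k + 2) - Z (k + 2)) (U (k + 1) - Z (k + 1)) (Z (k + 2) - Z (k + 1))
    have : σ / 2 * (A * (‖U (k + 2) - Z (k + 2)‖ ^ 2 - ‖U (k + 1) - Z (k + 1)‖ ^ 2)
        + η * (‖U (k + 2) - Z (k + 2)‖ ^ 2 + ‖Z (k + 2) - Z (k + 1)‖ ^ 2)) ≤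
        σ / 2 * ((2 - τ) * ‖U (k + 2) - Z (k + 2)‖ ^ 2 + ‖Z (k + 2) - Z (k + 1)‖ ^ 2
        + 2 * inner ℝ (Z (k + 2) - Z (k + 1)) (U (k + 2) - Z (k + 2))) := by
      refine mul_le_mul_of_nonneg_left ?_ (by positivity)
      linarith
    simp only [Ψ, D] at *
    linarith
  have hsum := sum_le_of_perturbed_descent (T := T) hK0 hΨ hD (fun k => hε0 (k + 1))
    (fun N => hεs.sum_le_tsum _ (fun i _ => hε0 (i + 1))) hΨ0 desc N
  have hDS : ∑ k ∈ Finset.range N, (‖U (k + 2) - Z (k + 2)‖ ^ 2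
      + ‖Z (k + 2) - Z (k + 1)‖ ^ 2 + μ * ‖U (k + 2)‖ ^ 2) ≤ S := by
    rw [hS, le_div_iff₀ hκ0, Finset.sum_mul]
    refine (Finset.sum_le_sum fun k _ => ?_).trans hsum
    have k₁ : κ ≤ 1 := min_le_left _ _
    have k₂ : κ ≤ σ / 2 * η := min_le_right _ _
    have q₁ : 0 ≤ ‖U (k + 2) - Z (k + 2)‖ ^ 2 + ‖Z (k + 2) - Z (k + 1)‖ ^ 2 := by positivity
    have q₂ : 0 ≤ μ * ‖U (k + 2)‖ ^ 2 := by positivity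
    have := mul_le_mul_of_nonneg_right k₁ q₂
    have := mul_le_mul_of_nonneg_right k₂ q₁
    simp only [D]
    linarith
  -- Restores the first step omitted by the shifted energy; the `μ`-term already carries the shifted
  -- index.
  have hμsum : ∑ k ∈ Finset.range N, (‖U (k + 1) - Z (k + 1)‖ ^ 2 + ‖Z (k + 1) - Z k‖ ^ 2) ≤
      ∑ k ∈ Finset.range N, (‖U (k + 2) - Z (k + 2)‖ ^ 2 + ‖Z (k + 2) - Z (k + 1)‖ ^ 2)
        + (‖U 1 - Z 1‖ ^ 2 + ‖Z 1 - Z 0‖ ^ 2) := by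
    have := Finset.sum_range_succ' (fun k => ‖U (k + 1) - Z (k + 1)‖ ^ 2 + ‖Z (k + 1) - Z k‖ ^ 2) N
    simp only [zero_add] at this
    rw [← this, Finset.sum_range_succ]
    have : 0 ≤ ‖U (N + 1) - Z (N + 1)‖ ^ 2 + ‖Z (N + 1) - Z N‖ ^ 2 := by positivity
    linarith
  rw [Finset.sum_add_distrib] at hDS ⊢
  have p₁ : ‖U 1 - Z 1‖ ^ 2 ≤ m ^ 2 := by gcongr
  have p₂ : ‖Z 1 - Z 0‖ ^ 2 ≤ (m + b) ^ 2 := by gcongr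
  linarith

end ADMM

end SparseControl

noncomputable section
namespace SparseControl

/-! ### Poincaré inequality on `H¹₀`. -/

section Poincare

variable {n : ℕ} {Ω : Set (E n)}

/-- **Poincaré inequality** for smooth functions supported in a bounded set. -/
theorem integral_sq_le_of_tsupport_subset (i : Fin n) {r : ℝ} (hr : ∀ x ∈ Ω, ‖x‖ ≤ r)
    {φ : E n → ℝ} (hφ : ContDiff ℝ ∞ φ) (hc : HasCompactSupport φ) (hs : tsupport φ ⊆ Ω) :
    ∫ x, φ x ^ 2 ≤ 4 * r ^ 2 * ∫ x, ‖gradient φ x‖ ^ 2 := by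
  have hd : Differentiable ℝ φ := hφ.differentiable (by simp)
  have hcont : Continuous φ := hφ.continuous
  have hfd : Continuous (fderiv ℝ φ) := hφ.continuous_fderiv (by simp)
  have hgrad : Continuous (gradient φ) :=
    (InnerProductSpace.toDual ℝ (E n)).symm.continuous.comp hfd
  have hgc : HasCompactSupport (gradient φ) :=
    (hc.fderiv ℝ).comp_left (map_zero (InnerProductSpace.toDual ℝ (E n)).symm)
  let e : E n := EuclideanSpace.single i 1
  let g : E n →L[ℝ] ℝ := EuclideanSpace.proj i
  have he : ‖e‖ = 1 := by simp [e]
  have hge : g e = 1 := by simp [g, e]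
  have hf' : ∀ x v, fderiv ℝ (fun x => φ x ^ 2) x v = 2 * φ x * fderiv ℝ φ x v := by
    intro x v
    rw [((hd x).hasFDerivAt.pow 2).fderiv]
    simp
  have c₂ : HasCompactSupport fun x => φ x ^ 2 :=
    hc.comp_left (g := fun t : ℝ => t ^ 2) (by simp)
  -- Since `∂ᵢxᵢ = 1`, integrating `φ²` by parts against the coordinate `xᵢ` gives `∫ φ² = -∫ 2 φ
  -- ∂ᵢφ xᵢ`; `|xᵢ| ≤ r` on `Ω`, and half of `∫ φ²` is then absorbed.
  have ibp := integral_mul_fderiv_eq_neg_fderiv_mul_of_integrable (μ := (volume : Measure (E n)))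
    (f := fun x => φ x ^ 2) (g := g) (v := e)
    (by
      simp only [hf']
      refine Continuous.integrable_of_hasCompactSupport (by fun_prop) ?_
      exact ((hc.mul_left (f := fun _ => (2 : ℝ))).mul_right).mul_right)
    (by
      refine Continuous.integrable_of_hasCompactSupport ?_ c₂.mul_right
      simp only [ContinuousLinearMap.fderiv]
      fun_prop)
    (Continuous.integrable_of_hasCompactSupport (by fun_prop) c₂.mul_right)
    (fun x _ => (hd x).pow 2) (fun x _ => g.differentiableAt)
  simp only [ContinuousLinearMap.fderiv, hge, mul_one, hf'] at ibp
  have hi₁ : Integrable fun x => φ x ^ 2 :=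
    Continuous.integrable_of_hasCompactSupport (by fun_prop) c₂
  have hi₂ : Integrable fun x => ‖gradient φ x‖ ^ 2 :=
    Continuous.integrable_of_hasCompactSupport (by fun_prop)
      (hgc.comp_left (g := fun v : E n => ‖v‖ ^ 2) (by simp))
  have hpt : ∀ x, -(2 * φ x * fderiv ℝ φ x e * g x) ≤
      1 / 2 * φ x ^ 2 + 2 * r ^ 2 * ‖gradient φ x‖ ^ 2 := by
    intro x
    by_cases hx : x ∈ Ω
    · have h₁ : |fderiv ℝ φ x e| ≤ ‖gradient φ x‖ := by
        have : ‖gradient φ x‖ = ‖fderiv ℝ φ x‖ := by simp [gradient]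
        rw [this]
        simpa [he] using (fderiv ℝ φ x).le_opNorm e
      have h₂ : |g x| ≤ r := (by simpa [g] using PiLp.norm_apply_le x i : |g x| ≤ ‖x‖).trans (hr x hx)
      have h₃ : |fderiv ℝ φ x e * g x| ≤ ‖gradient φ x‖ * r := by
        rw [abs_mul]; gcongr
      have h₄ : (fderiv ℝ φ x e * g x) ^ 2 ≤ (‖gradient φ x‖ * r) ^ 2 :=
        sq_le_sq' (abs_le.mp h₃).1 (abs_le.mp h₃).2
      nlinarith [sq_nonneg (φ x + 2 * (fderiv ℝ φ x e * g x))]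
    · have : φ x = 0 := by
        by_contra h
        exact hx (hs (subset_tsupport _ h))
      rw [this]
      have : 0 ≤ 2 * r ^ 2 * ‖gradient φ x‖ ^ 2 := by positivity
      simpa using this
  have key : ∫ x, φ x ^ 2 ≤ (1 / 2 * ∫ x, φ x ^ 2) + 2 * r ^ 2 * ∫ x, ‖gradient φ x‖ ^ 2 := by
    calc ∫ x, φ x ^ 2 = ∫ x, -(2 * φ x * fderiv ℝ φ x e * g x) := by rw [ibp, integral_neg]
      _ ≤ ∫ x, (1 / 2 * φ x ^ 2 + 2 * r ^ 2 * ‖gradient φ x‖ ^ 2) := by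
        refine integral_mono ?_ ((hi₁.const_mul _).add (hi₂.const_mul _)) hpt
        refine (Continuous.integrable_of_hasCompactSupport (by fun_prop) ?_).neg
        exact ((hc.mul_left (f := fun _ => (2 : ℝ))).mul_right).mul_right
      _ = _ := by
        rw [integral_add (hi₁.const_mul _) (hi₂.const_mul _), integral_const_mul,
          integral_const_mul]
  linarith

theorem norm_sq_eq_integral {F : Type*} [NormedAddCommGroup F] [InnerProductSpace ℝ F]
    (w : Lp F 2 (volume.restrict Ω)) : ‖w‖ ^ 2 = ∫ x in Ω, ‖w x‖ ^ 2 := by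
  rw [← real_inner_self_eq_norm_sq, L2.inner_def]
  simp

/-- **Poincaré inequality** in `H¹₀(Ω)` for a bounded set `Ω`. -/
theorem exists_norm_toL2_le (hn : 0 < n) (hΩ : Bornology.IsBounded Ω) :
    ∃ c : ℝ, 0 ≤ c ∧ ∀ y : H10 Ω, ‖toL2 y‖ ^ 2 ≤ c * ‖grad y‖ ^ 2 := by
  obtain ⟨r, hr⟩ := hΩ.exists_norm_le
  refine ⟨4 * r ^ 2, by positivity, fun y => ?_⟩
  -- The inequality is a closed condition on pairs, so it passes from test functions to their
  -- closure.
  have hclosed : IsClosed {w : Pair Ω | ‖w.fst‖ ^ 2 ≤ 4 * r ^ 2 * ‖w.snd‖ ^ 2} :=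
    isClosed_le (((WithLp.fstL 2 ℝ (L2 Ω) (L2Vec Ω)).continuous.norm).pow 2)
      (continuous_const.mul (((WithLp.sndL 2 ℝ (L2 Ω) (L2Vec Ω)).continuous.norm).pow 2))
  refine closure_minimal ?_ hclosed y.2
  rintro w ⟨φ, h₁, h₂, h₃, h₄, h₅⟩
  have hout : ∀ x, x ∉ Ω → φ x = 0 := fun x hx => by
    by_contra h
    exact hx (h₃ (subset_tsupport _ h))
  have hoz : ∀ x, x ∉ Ω → gradient φ x = 0 := fun x hx => by
    have : fderiv ℝ φ x = 0 := by
      by_contra h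
      exact hx (h₃ (support_fderiv_subset ℝ (Function.mem_support.mpr h)))
    simp [gradient, this]
  have e₁ : ‖w.fst‖ ^ 2 = ∫ x, φ x ^ 2 := by
    rw [norm_sq_eq_integral, ← setIntegral_eq_integral_of_forall_compl_eq_zero (s := Ω)
      (f := fun x => φ x ^ 2) fun x hx => by simp [hout x hx]]
    refine integral_congr_ae ?_
    filter_upwards [h₄] with x hx
    simp [hx]
  have e₂ : ‖w.snd‖ ^ 2 = ∫ x, ‖gradient φ x‖ ^ 2 := by
    rw [norm_sq_eq_integral, ← setIntegral_eq_integral_of_forall_compl_eq_zero (s := Ω)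
      (f := fun x => ‖gradient φ x‖ ^ 2) fun x hx => by simp [hoz x hx]]
    refine integral_congr_ae ?_
    filter_upwards [h₅] with x hx
    simp [hx]
  change ‖w.fst‖ ^ 2 ≤ 4 * r ^ 2 * ‖w.snd‖ ^ 2
  rw [e₁, e₂]
  exact integral_sq_le_of_tsupport_subset ⟨0, hn⟩ hr h₁ h₂ h₃

theorem norm_sq_H10 (y : H10 Ω) : ‖y‖ ^ 2 = ‖toL2 y‖ ^ 2 + ‖grad y‖ ^ 2 :=
  WithLp.prod_norm_sq_eq_of_L2 (y : Pair Ω)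

end Poincare

/-! ### The elliptic form and its solution operator. -/

section Form

variable {n : ℕ} {Ω : Set (E n)}

/-- The continuous bilinear form `(f, g) ↦ ∫ b f g` on `L²(Ω)` for `b ∈ L^∞(Ω)`. -/
def weightedPairing {b : E n → ℝ} (hb : MemLp b ⊤ (volume.restrict Ω)) :
    L2 Ω →L[ℝ] L2 Ω →L[ℝ] ℝ :=
  ((ContinuousLinearMap.mul ℝ ℝ).lpPairing (volume.restrict Ω) 2 2).comp
    ((ContinuousLinearMap.mul ℝ ℝ).holderL (volume.restrict Ω) ⊤ 2 2 hb.toLp)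

theorem integrable_weighted {b : E n → ℝ} (hb : MemLp b ⊤ (volume.restrict Ω)) {f g : E n → ℝ}
    (hf : MemLp f 2 (volume.restrict Ω)) (hg : MemLp g 2 (volume.restrict Ω)) :
    Integrable (fun x => b x * f x * g x) (volume.restrict Ω) :=
  (hf.mul (r := 2) hb).integrable_mul hg

theorem weightedPairing_apply {b : E n → ℝ} (hb : MemLp b ⊤ (volume.restrict Ω)) (f g : L2 Ω) :
    weightedPairing hb f g = ∫ x in Ω, b x * f x * g x := by
  rw [weightedPairing, ContinuousLinearMap.comp_apply, ContinuousLinearMap.lpPairing_eq_integral]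
  refine integral_congr_ae ?_
  filter_upwards [(ContinuousLinearMap.mul ℝ ℝ).coeFn_holder (r := 2) hb.toLp f, hb.coeFn_toLp]
    with x h₁ h₂
  simp [h₁, h₂]

/-- The `i`-th weak partial derivative. -/
def partialL (i : Fin n) : H10 Ω →L[ℝ] L2 Ω :=
  ((EuclideanSpace.proj i : E n →L[ℝ] ℝ).compLpL 2 (volume.restrict Ω)).comp grad

theorem partialL_ae (i : Fin n) (y : H10 Ω) :
    partialL i y =ᵐ[volume.restrict Ω] fun x => grad y x i :=
  (EuclideanSpace.proj i : E n →L[ℝ] ℝ).coeFn_compLpL _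

namespace Problem

variable {P : Problem Ω}

/-- The bilinear form of the problem as a continuous bilinear map. -/
def Admissible.formL (hP : P.Admissible) : H10 Ω →L[ℝ] H10 Ω →L[ℝ] ℝ :=
  (∑ i, ∑ j, (weightedPairing (hP.A_bdd i j)).bilinearComp (partialL i) (partialL j))
    + (weightedPairing hP.c₀_bdd).bilinearComp toL2 toL2

theorem memLp_grad (y : H10 Ω) (i : Fin n) :
    MemLp (fun x => grad y x i) 2 (volume.restrict Ω) :=
  (Lp.memLp (partialL i y)).ae_eq (partialL_ae i y)

theorem Admissible.integrable_A (hP : P.Admissible) (y v : H10 Ω) (i j : Fin n) :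
    Integrable (fun x => P.A i j x * grad y x i * grad v x j) (volume.restrict Ω) :=
  integrable_weighted (hP.A_bdd i j) (memLp_grad y i) (memLp_grad v j)

theorem Admissible.integrable_c₀ (hP : P.Admissible) (y v : H10 Ω) :
    Integrable (fun x => P.c₀ x * toL2 y x * toL2 v x) (volume.restrict Ω) :=
  integrable_weighted hP.c₀_bdd (Lp.memLp _) (Lp.memLp _)

theorem Admissible.formL_apply (hP : P.Admissible) (y v : H10 Ω) :
    hP.formL y v = P.form y v := by
  have hA := hP.integrable_A y v
  rw [form, integral_add (integrable_finsetSum _ fun i _ => integrable_finsetSum _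
    fun j _ => hA i j) (hP.integrable_c₀ y v), integral_finsetSum _ fun i _ =>
      integrable_finsetSum _ fun j _ => hA i j]
  simp only [Admissible.formL, _root_.add_apply, _root_.sum_apply,
    ContinuousLinearMap.bilinearComp_apply, weightedPairing_apply]
  congr 1
  refine Finset.sum_congr rfl fun i _ => ?_
  rw [integral_finsetSum _ fun j _ => hA i j]
  refine Finset.sum_congr rfl fun j _ => integral_congr_ae ?_
  filter_upwards [partialL_ae i y, partialL_ae j v] with x h₁ h₂
  rw [h₁, h₂]

theorem Admissible.form_symm (hP : P.Admissible) (y v : H10 Ω) : P.form y v = P.form v y := by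
  refine integral_congr_ae ?_
  filter_upwards [hP.A_symm] with x hx
  rw [Finset.sum_comm]
  congr 1
  · refine Finset.sum_congr rfl fun i _ => Finset.sum_congr rfl fun j _ => ?_
    rw [hx j i]; ring
  · ring

/-- Ellipticity and `c₀ ≥ 0` control `θ‖∇y‖²`; Poincaré turns this into the full norm at the price
of the factor `1 / (c + 1)`. -/
theorem Admissible.isCoercive (hP : P.Admissible) (hn : 0 < n) (hΩ : Bornology.IsBounded Ω) :
    IsCoercive hP.formL := by
  obtain ⟨θ, hθ, hell⟩ := hP.A_elliptic
  obtain ⟨c, hc, hpoin⟩ := exists_norm_toL2_le (Ω := Ω) hn hΩ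
  refine ⟨θ / (c + 1), by positivity, fun y => ?_⟩
  have hform : θ * ‖grad y‖ ^ 2 ≤ hP.formL y y := by
    rw [hP.formL_apply, form, norm_sq_eq_integral, ← integral_const_mul]
    have hg : Integrable (fun x => ‖grad y x‖ ^ 2) (volume.restrict Ω) :=
      (Lp.memLp (grad y)).integrable_norm_pow (by norm_num)
    refine integral_mono_ae (hg.const_mul θ) ((integrable_finsetSum _ fun i _ =>
      integrable_finsetSum _ fun j _ => hP.integrable_A y y i j).add (hP.integrable_c₀ y y)) ?_
    filter_upwards [hell, hP.c₀_nonneg] with x h₁ h₂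
    have := h₁ (grad y x)
    have := mul_nonneg h₂ (mul_self_nonneg (toL2 y x))
    simp only [mul_assoc] at *
    linarith
  have hn : ‖y‖ ^ 2 ≤ (c + 1) * ‖grad y‖ ^ 2 := by
    rw [norm_sq_H10]; linarith [hpoin y]
  refine le_trans ?_ hform
  calc θ / (c + 1) * ‖y‖ * ‖y‖ = θ / (c + 1) * ‖y‖ ^ 2 := by ring
    _ ≤ θ / (c + 1) * ((c + 1) * ‖grad y‖ ^ 2) := by gcongr
    _ = θ * ‖grad y‖ ^ 2 := by field_simp

instance : CompleteSpace (H10 Ω) :=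
  (Submodule.isClosed_topologicalClosure (testPairs Ω)).completeSpace_coe

/-- The solution operator is a continuous linear map. -/
theorem Admissible.exists_solutionCLM (hP : P.Admissible) (hn : 0 < n)
    (hΩ : Bornology.IsBounded Ω) :
    ∃ T : Hm1 Ω →L[ℝ] H10 Ω, (∀ F, P.S F = T F) ∧ (∀ F, P.Sadj F = T F) ∧
      ∀ F G : Hm1 Ω, F (T G) = G (T F) := by
  have hco := hP.isCoercive hn hΩ
  let T : Hm1 Ω →L[ℝ] H10 Ω :=
    { toFun := fun F => hco.continuousLinearEquivOfBilin.symm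
        ((InnerProductSpace.toDual ℝ (H10 Ω)).symm F)
      map_add' := fun F G => by simp
      map_smul' := fun c F => by simp
      cont := hco.continuousLinearEquivOfBilin.symm.continuous.comp
        (InnerProductSpace.toDual ℝ (H10 Ω)).symm.continuous }
  have hT : ∀ F v, P.form (T F) v = F v := by
    intro F v
    rw [← hP.formL_apply, ← hco.continuousLinearEquivOfBilin_apply]
    simp [T]
  -- Coercivity gives uniqueness, so the choice made by `Classical.epsilon` in `S` must be the
  -- Lax–Milgram solution.
  have huniq : ∀ y F, (∀ v, P.form y v = F v) → y = T F := by
    intro y F hy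
    obtain ⟨c, hc, hcc⟩ := hco
    have h0 : hP.formL (y - T F) (y - T F) = 0 := by
      rw [map_sub hP.formL, _root_.sub_apply, hP.formL_apply, hP.formL_apply, hy, hT, sub_self]
    have h₁ := hcc (y - T F)
    rw [h0] at h₁
    have : ‖y - T F‖ = 0 := by
      by_contra hne
      have : 0 < ‖y - T F‖ := lt_of_le_of_ne (norm_nonneg _) (Ne.symm hne)
      have : 0 < c * ‖y - T F‖ * ‖y - T F‖ := by positivity
      linarith
    exact sub_eq_zero.mp (norm_eq_zero.mp this)
  have hS : ∀ F, P.S F = T F := fun F =>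
    huniq _ F (Classical.epsilon_spec (p := fun y => ∀ v, P.form y v = F v) ⟨T F, hT F⟩)
  have hsym : ∀ F G : Hm1 Ω, F (T G) = G (T F) := fun F G => by
    rw [← hT F, hP.form_symm, hT]
  refine ⟨T, hS, fun F => ?_, hsym⟩
  have hspec := Classical.epsilon_spec (p := fun p => ∀ G : Hm1 Ω, G p = F (P.S G))
    ⟨T F, fun G => by rw [hS, hsym]⟩
  change ∀ G : Hm1 Ω, G (P.Sadj F) = F (P.S G) at hspec
  -- Riesz representatives, as functionals `G`, separate points; hence the chosen adjoint is `T` as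
  -- well.
  refine ext_inner_left ℝ fun v => ?_
  have := hspec (InnerProductSpace.toDual ℝ _ v)
  rw [hS, hsym] at this
  simpa using this

end Problem

end Form

end SparseControl
end

noncomputable section
namespace SparseControl

/-! ### Reduced cost: gradient, subdifferential and optimality conditions. -/

variable {n : ℕ} {Ω : Set (E n)}

/-- The embedding `L²(Ω) → H⁻¹(Ω)` as a continuous linear map. -/
def toHm1L : L2 Ω →L[ℝ] Hm1 Ω where
  toFun := toHm1
  map_add' v w := by ext; simp [toHm1]
  map_smul' c w := by ext; simp [toHm1]
  cont := (innerSL ℝ).continuous.clm_comp continuous_const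

namespace Problem

variable {P : Problem Ω}

/-- `Y` is the solution operator restricted to `L²(Ω)`, and it is also its adjoint. -/
structure IsControlToState (P : Problem Ω) (Y : L2 Ω →L[ℝ] H10 Ω) : Prop where
  state_eq : ∀ u, P.state u = Y (u + P.yc)
  adjState_eq : ∀ y, P.adjState y = Y (P.yd - toL2 y)
  symm : ∀ v w : L2 Ω, inner ℝ (toL2 (Y v)) w = inner ℝ v (toL2 (Y w))

theorem Admissible.exists_isControlToState (hP : P.Admissible) (hn : 0 < n)
    (hΩ : Bornology.IsBounded Ω) : ∃ Y, P.IsControlToState Y := by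
  obtain ⟨T, hS, hSadj, hsym⟩ := hP.exists_solutionCLM hn hΩ
  refine ⟨T.comp toHm1L, fun u => hS _, fun y => hSadj _, fun v w => ?_⟩
  rw [real_inner_comm]
  exact hsym (toHm1 w) (toHm1 v)

/-- The gradient of the smooth part `f`, in terms of the control-to-state operator. -/
def gradF (P : Problem Ω) (Y : L2 Ω →L[ℝ] H10 Ω) (u : L2 Ω) : L2 Ω :=
  (P.α / 2) • u + toL2 (Y (toL2 (Y (u + P.yc)) - P.yd))

variable {Y : L2 Ω →L[ℝ] H10 Ω}

theorem IsControlToState.hasGradientAt (hY : P.IsControlToState Y) (u : L2 Ω) :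
    HasGradientAt P.f (P.gradF Y u) u := by
  have hf : P.f = fun u => 1 / 2 * ‖toL2 (Y (u + P.yc)) - P.yd‖ ^ 2 + P.α / 4 * ‖u‖ ^ 2 := by
    funext u
    rw [f, hY.state_eq]
  rw [hasGradientAt_iff_hasFDerivAt, hf]
  have h₁ : HasFDerivAt (fun u => toL2 (Y (u + P.yc)) - P.yd) (toL2.comp Y) u :=
    ((toL2.comp Y).hasFDerivAt.comp u ((hasFDerivAt_id u).add_const P.yc)).sub_const P.yd
  refine ((h₁.norm_sq.const_mul (1 / 2)).add
    ((hasFDerivAt_id u).norm_sq.const_mul (P.α / 4))).congr_fderiv ?_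
  ext v
  simp [gradF, hY.symm]
  ring

theorem gradF_sub (u v : L2 Ω) :
    P.gradF Y u - P.gradF Y v = (P.α / 2) • (u - v) + toL2 (Y (toL2 (Y (u - v)))) := by
  have : toL2 (Y (toL2 (Y (u - v)))) = toL2 (Y (toL2 (Y (u + P.yc)) - P.yd))
      - toL2 (Y (toL2 (Y (v + P.yc)) - P.yd)) := by
    rw [← map_sub, ← map_sub, sub_sub_sub_cancel_right, ← map_sub, ← map_sub,
      add_sub_add_right_eq_sub]
  rw [gradF, gradF, this]
  module

/-- By symmetry the tracking part contributes `‖Y(u - v)‖²` in `L²`, so the modulus comes from the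
Tikhonov term alone. -/
theorem IsControlToState.gradF_strongMono (hY : P.IsControlToState Y) (u v : L2 Ω) :
    P.α / 2 * ‖u - v‖ ^ 2 ≤ inner ℝ (P.gradF Y u - P.gradF Y v) (u - v) := by
  rw [gradF_sub, inner_add_left, real_inner_smul_left, real_inner_self_eq_norm_sq, hY.symm,
    real_inner_self_eq_norm_sq]
  have : 0 ≤ ‖toL2 (Y (u - v))‖ ^ 2 := by positivity
  linarith

/-- The real-valued part of `g`. -/
def gReal (P : Problem Ω) (z : L2 Ω) : ℝ := P.α / 4 * ‖z‖ ^ 2 + P.β * normL1 z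

theorem g_of_mem {z : L2 Ω} (hz : z ∈ P.Uad) : P.g z = (P.gReal z : EReal) := by
  simp [g, gReal, hz]

theorem g_of_notMem {z : L2 Ω} (hz : z ∉ P.Uad) : P.g z = ⊤ := by
  rw [g, if_neg hz, EReal.coe_add_top]

theorem augLag_of_mem {σ : ℝ} {u z lam : L2 Ω} (hz : z ∈ P.Uad) :
    P.augLag σ u z lam =
      ((P.f u + P.gReal z + (inner ℝ lam (u - z) + σ / 2 * ‖u - z‖ ^ 2) : ℝ) : EReal) := by
  rw [augLag, g_of_mem hz]
  push_cast
  rfl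

theorem augLag_of_notMem {σ : ℝ} {u z lam : L2 Ω} (hz : z ∉ P.Uad) :
    P.augLag σ u z lam = ⊤ := by
  rw [augLag, g_of_notMem hz, EReal.coe_add_top, EReal.top_add_coe]

theorem mem_subdiffG_iff {z ξ : L2 Ω} (hz : z ∈ P.Uad) :
    ξ ∈ P.subdiffG z ↔ ∀ w ∈ P.Uad, P.gReal z + inner ℝ ξ (w - z) ≤ P.gReal w := by
  refine ⟨fun h w hw => ?_, fun h w => ?_⟩
  · have := h w
    rw [g_of_mem hz, g_of_mem hw] at this
    exact_mod_cast this
  · by_cases hw : w ∈ P.Uad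
    · rw [g_of_mem hz, g_of_mem hw]
      exact_mod_cast h w hw
    · rw [g_of_notMem hw]
      exact le_top

theorem subdiffG_mono {z w ξ ζ : L2 Ω} (hz : z ∈ P.Uad) (hw : w ∈ P.Uad)
    (hξ : ξ ∈ P.subdiffG z) (hζ : ζ ∈ P.subdiffG w) : 0 ≤ inner ℝ (ξ - ζ) (z - w) := by
  have h₁ := (mem_subdiffG_iff hz).1 hξ w hw
  have h₂ := (mem_subdiffG_iff hw).1 hζ z hz
  rw [← neg_sub z w, inner_neg_right] at h₁
  rw [inner_sub_left]
  linarith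

theorem segment_mem_Uad {z w : L2 Ω} (hz : z ∈ P.Uad) (hw : w ∈ P.Uad) {t : ℝ}
    (ht : 0 ≤ t) (ht' : t ≤ 1) : z + t • (w - z) ∈ P.Uad := by
  change ∀ᵐ x ∂_, _
  filter_upwards [hz, hw, Lp.coeFn_add z (t • (w - z)), Lp.coeFn_smul t (w - z),
    Lp.coeFn_sub w z] with x h₁ h₂ e₁ e₂ e₃
  rw [e₁, Pi.add_apply, e₂, Pi.smul_apply, e₃, Pi.sub_apply, smul_eq_mul]
  constructor <;> nlinarith

theorem integrable_abs [IsFiniteMeasure (volume.restrict Ω)] (z : L2 Ω) :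
    Integrable (fun x => |z x|) (volume.restrict Ω) :=
  ((Lp.memLp z).integrable one_le_two).abs

theorem normL1_segment_le [IsFiniteMeasure (volume.restrict Ω)] (z w : L2 Ω) {t : ℝ}
    (ht : 0 ≤ t) (ht' : t ≤ 1) :
    normL1 (z + t • (w - z)) ≤ normL1 z + t * (normL1 w - normL1 z) := by
  have e : normL1 z + t * (normL1 w - normL1 z) = ∫ x in Ω, ((1 - t) * |z x| + t * |w x|) := by
    rw [integral_add ((integrable_abs z).const_mul _) ((integrable_abs w).const_mul _),
      integral_const_mul, integral_const_mul, normL1, normL1]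
    ring
  rw [e]
  refine integral_mono_ae (integrable_abs _)
    (((integrable_abs z).const_mul _).add ((integrable_abs w).const_mul _)) ?_
  filter_upwards [Lp.coeFn_add z (t • (w - z)), Lp.coeFn_smul t (w - z),
    Lp.coeFn_sub w z] with x e₁ e₂ e₃
  simp only [e₁, Pi.add_apply, e₂, Pi.smul_apply, e₃, Pi.sub_apply, smul_eq_mul]
  calc |z x + t * (w x - z x)| = |(1 - t) * z x + t * w x| := by ring_nf
    _ ≤ |(1 - t) * z x| + |t * w x| := abs_add_le _ _
    _ = _ := by rw [abs_mul, abs_mul, abs_of_nonneg ht, abs_of_nonneg (sub_nonneg.2 ht')]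

theorem Admissible.gReal_segment_le [IsFiniteMeasure (volume.restrict Ω)] (hP : P.Admissible)
    (z w : L2 Ω) {t : ℝ} (ht : 0 ≤ t) (ht' : t ≤ 1) :
    P.gReal (z + t • (w - z)) ≤ P.gReal z + t * (P.gReal w - P.gReal z) := by
  have h₁ := mul_le_mul_of_nonneg_left (normL1_segment_le z w ht ht') hP.β_pos.le
  have h₂ : ‖z + t • (w - z)‖ ^ 2 ≤ ‖z‖ ^ 2 + t * (‖w‖ ^ 2 - ‖z‖ ^ 2) := by
    have e₁ : ‖z + t • (w - z)‖ ^ 2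
        = ‖z‖ ^ 2 + 2 * (t * inner ℝ z (w - z)) + t ^ 2 * ‖w - z‖ ^ 2 := by
      rw [norm_add_sq_real, real_inner_smul_right, norm_smul, mul_pow, Real.norm_eq_abs, sq_abs]
    have e₂ : ‖w‖ ^ 2 = ‖z‖ ^ 2 + 2 * inner ℝ z (w - z) + ‖w - z‖ ^ 2 := by
      rw [← norm_add_sq_real, add_sub_cancel]
    rw [e₁, e₂]
    nlinarith [mul_nonneg (mul_nonneg ht (sub_nonneg.2 ht')) (sq_nonneg ‖w - z‖)]
  have h₃ := mul_le_mul_of_nonneg_left h₂ (by linarith [hP.α_pos] : 0 ≤ P.α / 4)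
  simp only [gReal]
  linarith

/-- Optimality condition for the `z`-subproblem. -/
theorem Admissible.mem_subdiffG_of_isMinOn [IsFiniteMeasure (volume.restrict Ω)]
    (hP : P.Admissible) {σ : ℝ} {u z lam : L2 Ω} (hσ : 0 < σ) (hz : z ∈ P.Uad)
    (hmin : IsMinOn (fun w => P.augLag σ u w lam) univ z) :
    lam + σ • (u - z) ∈ P.subdiffG z := by
  rw [mem_subdiffG_iff hz]
  intro w hw
  by_contra! hlt
  set q := inner ℝ (lam + σ • (u - z)) (w - z) with hq
  set c := σ / 2 * ‖w - z‖ ^ 2 with hc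
  have hc0 : 0 ≤ c := by positivity
  set X := P.gReal z + q - P.gReal w with hX
  have hX0 : 0 < X := by linarith
  -- Minimality against the segment point `z + t(w - z)`, divided by `t`: the gap `X` in the
  -- subgradient inequality is at most the quadratic remainder `t c`, impossible for small `t`.
  have key : ∀ t : ℝ, 0 < t → t ≤ 1 → X ≤ t * c := by
    intro t ht ht'
    have hm : P.augLag σ u z lam ≤ P.augLag σ u (z + t • (w - z)) lam := hmin (mem_univ _)
    rw [augLag_of_mem hz, augLag_of_mem (segment_mem_Uad hz hw ht.le ht'),
      EReal.coe_le_coe_iff] at hm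
    have hs := hP.gReal_segment_le z w ht.le ht'
    have e₀ : u - (z + t • (w - z)) = (u - z) - t • (w - z) := by abel
    have e₁ : ‖u - (z + t • (w - z))‖ ^ 2
        = ‖u - z‖ ^ 2 - 2 * (t * inner ℝ (u - z) (w - z)) + t ^ 2 * ‖w - z‖ ^ 2 := by
      rw [e₀, norm_sub_sq_real, real_inner_smul_right, norm_smul, mul_pow, Real.norm_eq_abs,
        sq_abs]
    have e₂ : inner ℝ lam (u - (z + t • (w - z)))
        = inner ℝ lam (u - z) - t * inner ℝ lam (w - z) := by
      rw [e₀, inner_sub_right, real_inner_smul_right]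
    have e₃ : q = inner ℝ lam (w - z) + σ * inner ℝ (u - z) (w - z) := by
      rw [hq, inner_add_left, real_inner_smul_left]
    rw [e₁, e₂] at hm
    have : t * X ≤ t * (t * c) := by
      rw [hX, e₃, hc]
      nlinarith
    exact le_of_mul_le_mul_left this ht
  set t := min 1 (X / (2 * (c + 1))) with ht
  have ht0 : 0 < t := by positivity
  have h₁ := key t ht0 (min_le_left _ _)
  have h₂ : t * (2 * (c + 1)) ≤ X := by
    rw [← le_div_iff₀ (by positivity)]
    exact min_le_right _ _
  nlinarith

/-- Minimizers of the augmented Lagrangian in `z` are admissible. -/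
theorem mem_Uad_of_isMinOn {σ : ℝ} {u z z₀ lam : L2 Ω} (hz₀ : z₀ ∈ P.Uad)
    (hmin : IsMinOn (fun w => P.augLag σ u w lam) univ z) : z ∈ P.Uad := by
  by_contra hz
  have : P.augLag σ u z lam ≤ P.augLag σ u z₀ lam := hmin (mem_univ _)
  rw [augLag_of_notMem hz, augLag_of_mem hz₀, top_le_iff] at this
  exact EReal.coe_ne_top _ this

/-- Optimality condition for the inexact `u`-subproblem. -/
theorem IsControlToState.gradF_eq_of_isMinOn (hY : P.IsControlToState Y) {σ : ℝ}
    {u z lam δ : L2 Ω} (hz : z ∈ P.Uad)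
    (hmin : IsMinOn (fun v => P.augLag σ v z lam - ((inner ℝ δ v : ℝ) : EReal)) univ u) :
    P.gradF Y u = δ - lam - σ • (u - z) := by
  let ψ : L2 Ω → ℝ := fun v =>
    P.f v + P.gReal z + (inner ℝ lam (v - z) + σ / 2 * ‖v - z‖ ^ 2) - inner ℝ δ v
  have hψ : IsMinOn ψ univ u := by
    intro v _
    have hm : P.augLag σ u z lam - ((inner ℝ δ u : ℝ) : EReal) ≤
      P.augLag σ v z lam - ((inner ℝ δ v : ℝ) : EReal) := hmin (mem_univ v)
    rw [augLag_of_mem hz, augLag_of_mem hz, ← EReal.coe_sub, ← EReal.coe_sub,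
      EReal.coe_le_coe_iff] at hm
    exact hm
  have hd : HasGradientAt ψ (P.gradF Y u + (lam + σ • (u - z)) - δ) u := by
    have hf := hasGradientAt_iff_hasFDerivAt.1 (hY.hasGradientAt u)
    have hi : HasFDerivAt (fun v : L2 Ω => v - z) (ContinuousLinearMap.id ℝ (L2 Ω)) u :=
      (hasFDerivAt_id u).sub_const z
    have hl := (innerSL ℝ lam).hasFDerivAt (x := u - z) |>.comp u hi
    have hq := hi.norm_sq.const_mul (σ / 2)
    have hδ := (innerSL ℝ δ).hasFDerivAt (x := u)
    rw [hasGradientAt_iff_hasFDerivAt]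
    refine (((hf.add_const (P.gReal z)).add (hl.add hq)).sub hδ).congr_fderiv ?_
    ext v
    simp
    ring
  have h0 := (hψ.isLocalMin univ_mem).hasFDerivAt_eq_zero (hasGradientAt_iff_hasFDerivAt.1 hd)
  have h0' : P.gradF Y u + (lam + σ • (u - z)) - δ = 0 :=
    (map_eq_zero_iff _ (InnerProductSpace.toDual ℝ (L2 Ω)).injective).1 h0
  rw [← sub_eq_zero, ← h0']
  abel

/-- The multiplier of a KKT point is a subgradient of `g`. -/
theorem IsKKT.mem_subdiffG (hP : P.Admissible) {y p : H10 Ω} {u z lam : L2 Ω}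
    (h : P.IsKKT y u z p lam) : lam ∈ P.subdiffG z := by
  rw [mem_subdiffG_iff h.z_mem]
  intro w hw
  have hv := h.var_ineq w hw
  rw [inner_sub_left, real_inner_smul_left] at hv
  -- The variational inequality contains only the linearization of `α/4 ‖·‖²`; the remainder `α/4 ‖w
  -- - z‖²` has the right sign.
  have e : ‖w‖ ^ 2 = ‖z‖ ^ 2 + 2 * inner ℝ z (w - z) + ‖w - z‖ ^ 2 := by
    rw [← norm_add_sq_real, add_sub_cancel]
  have : 0 ≤ P.α / 4 * ‖w - z‖ ^ 2 := by
    have := hP.α_pos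
    positivity
  simp only [gReal, e]
  linarith

theorem IsKKT.gradF_eq (hY : P.IsControlToState Y) {y p : H10 Ω} {u z lam : L2 Ω}
    (h : P.IsKKT y u z p lam) : P.gradF Y u = -lam := by
  have h₁ := h.grad_eq
  rw [h.adj_eq, hY.adjState_eq, h.state_eq, hY.state_eq, ← neg_sub (toL2 _) P.yd, map_neg,
    map_neg] at h₁
  rw [eq_neg_iff_add_eq_zero, ← h₁, gradF]
  abel

end Problem

end SparseControl
end

noncomputable section
namespace SparseControl

/-! ### Rates for running minima of summable sequences. -/

section Rate

/-- The running minimum of a summable sequence is `O(1/k)`. -/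
theorem inf_Icc_le_of_sum_le {R : ℕ → ℝ≥0∞} {ρ : ℕ → ℝ} {C : ℝ}
    (hR : ∀ k, R (k + 1) ≤ ENNReal.ofReal (ρ k))
    (hC : ∀ N, ∑ k ∈ Finset.range N, ρ k ≤ C) {k : ℕ} (hk : 1 ≤ k) :
    (Finset.Icc 1 k).inf R ≤ ENNReal.ofReal (C / k) := by
  have hk' : (0 : ℝ) < k := by exact_mod_cast hk
  obtain ⟨i, hi, hle⟩ : ∃ i ∈ Finset.range k, ρ i ≤ C / k := by
    refine Finset.exists_le_of_sum_le ⟨0, by simp; omega⟩ ?_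
    rw [Finset.sum_const, Finset.card_range, nsmul_eq_mul, mul_div_cancel₀ _ hk'.ne']
    exact hC k
  have hi' := Finset.mem_range.1 hi
  calc (Finset.Icc 1 k).inf R ≤ R (i + 1) := Finset.inf_le (by simp; omega)
    _ ≤ ENNReal.ofReal (ρ i) := hR i
    _ ≤ _ := ENNReal.ofReal_le_ofReal hle

/-- The running minimum of a summable sequence is `o(1/k)`. -/
theorem tendsto_mul_inf_Icc_of_summable {R : ℕ → ℝ≥0∞} {ρ : ℕ → ℝ}
    (hR : ∀ k, R (k + 1) ≤ ENNReal.ofReal (ρ k)) (hρ : ∀ k, 0 ≤ ρ k) (hs : Summable ρ) :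
    Tendsto (fun k : ℕ => (k : ℝ≥0∞) * (Finset.Icc 1 k).inf R) atTop (𝓝 0) := by
  -- The minimum up to `k` is at most the average over the window from `k / 2` to `k`, which has at
  -- least `k / 2` terms and whose sum vanishes by convergence of the series.
  have htail : Tendsto (fun k => 2 * (∑ i ∈ Finset.range k, ρ i - ∑ i ∈ Finset.range (k / 2), ρ i))
      atTop (𝓝 0) := by
    have h₁ := hs.hasSum.tendsto_sum_nat
    have h₂ := h₁.comp (Nat.tendsto_div_const_atTop (two_ne_zero))
    simpa using (h₁.sub h₂).const_mul 2
  have htail' := ENNReal.tendsto_ofReal htail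
  rw [ENNReal.ofReal_zero] at htail'
  refine tendsto_of_tendsto_of_tendsto_of_le_of_le tendsto_const_nhds htail'
    (fun _ => zero_le) fun k => ?_
  rcases Nat.eq_zero_or_pos k with rfl | hk
  -- The infimum over the empty range is `⊤`, and `0 * ⊤ = 0`.
  · simp
  have hlt : k / 2 < k := Nat.div_lt_self hk one_lt_two
  have hcast : (k : ℝ) ≤ 2 * ((k - k / 2 : ℕ) : ℝ) := by
    have : k ≤ 2 * (k - k / 2) := by omega
    exact_mod_cast this
  have hpos : (0 : ℝ) < ((k - k / 2 : ℕ) : ℝ) := by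
    have : 0 < k - k / 2 := by omega
    exact_mod_cast this
  obtain ⟨i, hi, hle⟩ : ∃ i ∈ Finset.Ico (k / 2) k,
      ρ i ≤ (∑ i ∈ Finset.Ico (k / 2) k, ρ i) / ((k - k / 2 : ℕ) : ℝ) := by
    refine Finset.exists_le_of_sum_le ⟨k / 2, by simp [hlt]⟩ ?_
    rw [Finset.sum_const, Nat.card_Ico, nsmul_eq_mul, mul_div_cancel₀ _ hpos.ne']
  rw [le_div_iff₀ hpos, Finset.sum_Ico_eq_sub _ hlt.le] at hle
  have hi' := Finset.mem_Ico.1 hi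
  calc (k : ℝ≥0∞) * (Finset.Icc 1 k).inf R ≤ k * ENNReal.ofReal (ρ i) := by
        gcongr
        exact (Finset.inf_le (by simp; omega : i + 1 ∈ Finset.Icc 1 k)).trans (hR i)
    _ = ENNReal.ofReal (k * ρ i) := by
        rw [ENNReal.ofReal_mul (by positivity), ENNReal.ofReal_natCast]
    _ ≤ _ := by
        refine ENNReal.ofReal_le_ofReal ?_
        nlinarith [mul_le_mul_of_nonneg_right hcast (hρ i)]

end Rate

/-! ### From the abstract recursion to the control problem. -/

namespace Problem

variable {n : ℕ} {Ω : Set (E n)} {P : Problem Ω} {Y : L2 Ω →L[ℝ] H10 Ω}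
  {σ τ : ℝ} {ε : ℕ → ℝ} {u z lam : ℕ → L2 Ω}

theorem IsADMM.z_mem (h : P.IsADMM σ τ ε u z lam) (k : ℕ) : z k ∈ P.Uad := by
  cases k with
  | zero => exact h.z_init
  | succ k => exact mem_Uad_of_isMinOn h.z_init (h.z_step k)

theorem IsADMM.mem_subdiffG [IsFiniteMeasure (volume.restrict Ω)] (hP : P.Admissible)
    (hσ : 0 < σ) (h : P.IsADMM σ τ ε u z lam) (k : ℕ) :
    lam k + σ • (u (k + 1) - z (k + 1)) ∈ P.subdiffG (z (k + 1)) :=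
  hP.mem_subdiffG_of_isMinOn hσ (h.z_mem _) (h.z_step k)

theorem IsADMM.exists_gradF_eq (hY : P.IsControlToState Y) (h : P.IsADMM σ τ ε u z lam) :
    ∃ δ : ℕ → L2 Ω, ∀ k, ‖δ k‖ ≤ ε k ∧
      P.gradF Y (u (k + 1)) = δ k - lam k - σ • (u (k + 1) - z k) := by
  choose δ hδ hmin using h.u_step
  exact ⟨δ, fun k => ⟨hδ k, hY.gradF_eq_of_isMinOn (h.z_mem k) (hmin k)⟩⟩

/-- The errors of an inexact ADMM sequence satisfy the abstract error recursion. -/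
theorem IsADMM.errorRecursion [IsFiniteMeasure (volume.restrict Ω)] (hP : P.Admissible)
    (hY : P.IsControlToState Y) (hσ : 0 < σ) (h : P.IsADMM σ τ ε u z lam)
    {y' p' : H10 Ω} {u' z' lam' : L2 Ω} (hK : P.IsKKT y' u' z' p' lam') {δ : ℕ → L2 Ω}
    (hδ : ∀ k, ‖δ k‖ ≤ ε k ∧
      P.gradF Y (u (k + 1)) = δ k - lam k - σ • (u (k + 1) - z k)) :
    ErrorRecursion (P.α / 2) σ τ ε (fun k => u k - u') (fun k => z k - z')
      (fun k => lam k - lam') δ where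
  norm_le k := (hδ k).1
  grad_mono k := by
    have := hY.gradF_strongMono (u (k + 1)) u'
    rw [(hδ k).2, hK.gradF_eq hY] at this
    convert this using 2
    · rfl
    · rw [hK.u_eq_z]
      module
  subdiff_mono k := by
    have := subdiffG_mono (h.z_mem (k + 1)) hK.z_mem (h.mem_subdiffG hP hσ k)
      (hK.mem_subdiffG hP)
    convert this using 2
    · rfl
    · rw [hK.u_eq_z]
      module
  subdiff_mono_succ k := by
    have := subdiffG_mono (h.z_mem (k + 2)) (h.z_mem (k + 1)) (h.mem_subdiffG hP hσ (k + 1))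
      (h.mem_subdiffG hP hσ k)
    convert this using 2
    · rfl
    · rw [hK.u_eq_z]
      module
    · abel
  mult_step k := by
    rw [h.lam_step k, hK.u_eq_z]
    module

/-- A bound for the KKT residual of the ADMM iterates by successive differences. -/
theorem IsADMM.R_le [IsFiniteMeasure (volume.restrict Ω)] (hP : P.Admissible)
    (hY : P.IsControlToState Y) (hσ : 0 < σ) (hτ : 0 < τ) (h : P.IsADMM σ τ ε u z lam)
    {δ : ℕ → L2 Ω} (hδ : ∀ k, ‖δ k‖ ≤ ε k ∧
      P.gradF Y (u (k + 1)) = δ k - lam k - σ • (u (k + 1) - z k)) (k : ℕ) :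
    P.R (u (k + 1)) (z (k + 1)) (lam (k + 1)) ≤ ENNReal.ofReal
      ((4 + 3 * (τ * σ + σ) ^ 2 + 3 * σ ^ 2 + ((1 - τ) * σ) ^ 2) *
        (ε k ^ 2 + ‖u (k + 1) - z (k + 1)‖ ^ 2 + ‖z (k + 1) - z k‖ ^ 2)) := by
  set r := u (k + 1) - z (k + 1) with hr
  set d := z (k + 1) - z k with hd
  have e₁ : gradient P.f (u (k + 1)) + lam (k + 1) = δ k + (τ * σ) • r - σ • (r + d) := by
    rw [(hY.hasGradientAt _).gradient, (hδ k).2, h.lam_step k, hr, hd]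
    module
  have n₁ : ‖gradient P.f (u (k + 1)) + lam (k + 1)‖ ≤ ε k + (τ * σ + σ) * ‖r‖ + σ * ‖d‖ := by
    rw [e₁]
    have a₁ := norm_sub_le (δ k + (τ * σ) • r) (σ • (r + d))
    have a₂ := norm_add_le (δ k) ((τ * σ) • r)
    have a₃ := mul_le_mul_of_nonneg_left (norm_add_le r d) hσ.le
    rw [norm_smul, Real.norm_of_nonneg hσ.le] at a₁
    rw [norm_smul, Real.norm_of_nonneg (by positivity)] at a₂
    linarith [(hδ k).1]
  have n₂ : Metric.infEDist 0 ((fun ξ => -lam (k + 1) + ξ) '' P.subdiffG (z (k + 1))) ≤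
      ENNReal.ofReal (|(1 - τ) * σ| * ‖r‖) := by
    refine (Metric.infEDist_le_edist_of_mem
      (mem_image_of_mem _ (h.mem_subdiffG hP hσ k))).trans_eq ?_
    have : -lam (k + 1) + (lam k + σ • (u (k + 1) - z (k + 1))) = ((1 - τ) * σ) • r := by
      rw [h.lam_step k, hr]
      module
    rw [this, edist_comm, edist_zero_right, ← ofReal_norm, norm_smul, Real.norm_eq_abs]
  rw [R, ← ofReal_norm, ← ofReal_norm]
  calc _ ≤ ENNReal.ofReal (ε k + (τ * σ + σ) * ‖r‖ + σ * ‖d‖) ^ 2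
        + ENNReal.ofReal (|(1 - τ) * σ| * ‖r‖) ^ 2 + ENNReal.ofReal ‖r‖ ^ 2 := by
        gcongr
    _ = ENNReal.ofReal ((ε k + (τ * σ + σ) * ‖r‖ + σ * ‖d‖) ^ 2
        + (|(1 - τ) * σ| * ‖r‖) ^ 2 + ‖r‖ ^ 2) := by
        rw [← ENNReal.ofReal_pow ((norm_nonneg _).trans n₁), ← ENNReal.ofReal_pow (by positivity),
          ← ENNReal.ofReal_pow (by positivity), ← ENNReal.ofReal_add (by positivity)
          (by positivity), ← ENNReal.ofReal_add (by positivity) (by positivity)]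
    _ ≤ _ := by
        refine ENNReal.ofReal_le_ofReal ?_
        have s₁ : (ε k + (τ * σ + σ) * ‖r‖ + σ * ‖d‖) ^ 2 ≤
            3 * (ε k ^ 2 + (τ * σ + σ) ^ 2 * ‖r‖ ^ 2 + σ ^ 2 * ‖d‖ ^ 2) := by
          nlinarith [sq_nonneg (ε k - (τ * σ + σ) * ‖r‖), sq_nonneg (ε k - σ * ‖d‖),
            sq_nonneg ((τ * σ + σ) * ‖r‖ - σ * ‖d‖)]
        rw [mul_pow, sq_abs]
        have p₁ : 0 ≤ (1 + 3 * (τ * σ + σ) ^ 2 + 3 * σ ^ 2 + ((1 - τ) * σ) ^ 2) * ε k ^ 2 := by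
          positivity
        have p₂ : 0 ≤ (3 + 3 * σ ^ 2) * ‖r‖ ^ 2 := by positivity
        have p₃ : 0 ≤ (4 + 3 * (τ * σ + σ) ^ 2 + ((1 - τ) * σ) ^ 2) * ‖d‖ ^ 2 := by positivity
        nlinarith

/-- Convergence of the ADMM iterates from summability of the differences. -/
theorem IsControlToState.tendsto_errors (hY : P.IsControlToState Y) (hP : P.Admissible)
    (hε : Tendsto ε atTop (𝓝 0)) {y' p' : H10 Ω} {u' z' lam' : L2 Ω}
    (hK : P.IsKKT y' u' z' p' lam') {δ : ℕ → L2 Ω}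
    (hδ : ∀ k, ‖δ k‖ ≤ ε k ∧
      P.gradF Y (u (k + 1)) = δ k - lam k - σ • (u (k + 1) - z k))
    (hs : Summable fun k => ‖u (k + 1) - z (k + 1)‖ ^ 2 + ‖z (k + 1) - z k‖ ^ 2
      + P.α / 2 * ‖u (k + 2) - u'‖ ^ 2) :
    Tendsto (fun k => u k - u') atTop (𝓝 0) ∧ Tendsto (fun k => z k - z') atTop (𝓝 0) ∧
      Tendsto (fun k => lam k - lam') atTop (𝓝 0) := by
  have hα := hP.α_pos
  have of_sq : ∀ v : ℕ → L2 Ω, Tendsto (fun k => ‖v k‖ ^ 2) atTop (𝓝 0) →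
      Tendsto v atTop (𝓝 0) := fun v hv => by
    rw [tendsto_zero_iff_norm_tendsto_zero]
    simpa using hv.sqrt
  have h0 := hs.tendsto_atTop_zero
  have hu : Tendsto (fun k => u k - u') atTop (𝓝 0) := by
    rw [← tendsto_add_atTop_iff_nat 2]
    refine of_sq _ ?_
    have : Tendsto (fun k => P.α / 2 * ‖u (k + 2) - u'‖ ^ 2) atTop (𝓝 0) :=
      squeeze_zero (fun k => by positivity)
        (fun k => le_add_of_nonneg_left (by positivity)) h0
    have := this.const_mul (P.α / 2)⁻¹
    rw [mul_zero] at this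
    exact this.congr fun k => inv_mul_cancel_left₀ (by positivity) _
  have hr : Tendsto (fun k => u (k + 1) - z (k + 1)) atTop (𝓝 0) := by
    refine of_sq _ (squeeze_zero (fun k => by positivity) (fun k => ?_) h0)
    have : 0 ≤ ‖z (k + 1) - z k‖ ^ 2 + P.α / 2 * ‖u (k + 2) - u'‖ ^ 2 := by positivity
    linarith
  have hz : Tendsto (fun k => z k - z') atTop (𝓝 0) := by
    rw [← tendsto_add_atTop_iff_nat 1]
    have := ((tendsto_add_atTop_iff_nat 1).2 hu).sub hr
    rw [sub_zero] at this
    refine this.congr fun k => ?_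
    rw [hK.u_eq_z]
    abel
  refine ⟨hu, hz, ?_⟩
  have hd : Tendsto δ atTop (𝓝 0) := squeeze_zero_norm (fun k => (hδ k).1) hε
  have hu₁ := (tendsto_add_atTop_iff_nat 1).2 hu
  have hYY : Tendsto (fun k => toL2 (Y (toL2 (Y (u (k + 1) - u'))))) atTop (𝓝 0) := by
    have := ((toL2.comp (Y.comp (toL2.comp Y))).continuous.tendsto 0).comp hu₁
    rw [map_zero] at this
    exact this
  -- The `u`-equation minus its KKT counterpart expresses `λ^k - λ*` through `δ^k`, `u^{k+1} - u*`
  -- and `z^k - z*`, all of which tend to zero.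
  have := (hd.sub (((hu₁.const_smul (P.α / 2)).add hYY))).sub ((hu₁.sub hz).const_smul σ)
  simp only [smul_zero, sub_zero, add_zero] at this
  refine this.congr fun k => ?_
  rw [← gradF_sub (P := P), (hδ k).2, hK.gradF_eq hY, hK.u_eq_z]
  module

end Problem

end SparseControl

end

open SparseControl
theorem theorem2p3 {n : ℕ} (hn : n = 2 ∨ n = 3) (Ω : Set (E n))
    (hΩ_open : IsOpen Ω) (hΩ_bdd : Bornology.IsBounded Ω) (hΩ_conv : Convex ℝ Ω)
    (σ τ : ℝ) (hσ : 0 < σ) (hτ : 0 < τ) (hτ' : τ < (1 + √5) / 2)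
    (ε : ℕ → ℝ) (hε : ∀ k, 0 ≤ ε k) (hε_sum : Summable ε) :
    -- `C` is a function of the initial point and of the optimal solution only
    ∃ C : L2 Ω × L2 Ω × L2 Ω → L2 Ω × L2 Ω × L2 Ω → ℝ,
      ∀ P : Problem Ω, P.Admissible →
      ∀ (y' : H10 Ω) (u' z' : L2 Ω) (p' : H10 Ω) (lam' : L2 Ω), P.IsKKT y' u' z' p' lam' →
      ∀ u z lam : ℕ → L2 Ω, P.IsADMM σ τ ε u z lam →
      ∀ y p : ℕ → H10 Ω, (∀ k, y k = P.state (u k)) → (∀ k, p k = P.adjState (y k)) →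
        Tendsto (fun k => ‖u k - u'‖ + ‖z k - z'‖ + ‖lam k - lam'‖) atTop (𝓝 0) ∧
        Tendsto (fun k => ‖y k - y'‖ + ‖p k - p'‖) atTop (𝓝 0) ∧
        (∀ k : ℕ, 1 ≤ k →
          (Finset.Icc 1 k).inf (fun i => P.R (u i) (z i) (lam i))
            ≤ ENNReal.ofReal (C (u 0, z 0, lam 0) (u', z', lam') / k)) ∧
        Tendsto (fun k : ℕ => (k : ℝ≥0∞) *
          (Finset.Icc 1 k).inf (fun i => P.R (u i) (z i) (lam i))) atTop (𝓝 0) := by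
  have : IsFiniteMeasure (volume.restrict Ω) :=
    ⟨by rw [Measure.restrict_apply_univ]; exact hΩ_bdd.measure_lt_top⟩
  -- The bound is fixed before the problem data, so it cannot depend on `α`, the coefficients or the
  -- bounds.
  choose B hB using fun b : ℝ =>
    ErrorRecursion.exists_sum_bound (H := L2 Ω) hσ hτ hτ' hε_sum b
  have hε_sq : Summable fun k => ε k ^ 2 := by
    refine Summable.of_norm_bounded_eventually_nat hε_sum ?_
    filter_upwards [hε_sum.tendsto_atTop_zero.eventually_le_const zero_lt_one] with k hk
    rw [Real.norm_of_nonneg (sq_nonneg _)]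
    nlinarith [hε k]
  set κ := 4 + 3 * (τ * σ + σ) ^ 2 + 3 * σ ^ 2 + ((1 - τ) * σ) ^ 2 with hκ
  have hκ0 : 0 ≤ κ := by positivity
  -- The sum of the initial `z`- and `λ`-errors serves as the common bound `b` for both.
  refine ⟨fun s t => κ * (∑' k, ε k ^ 2 + B (‖s.2.1 - t.2.1‖ + ‖s.2.2 - t.2.2‖)),
    fun P hP y' u' z' p' lam' hK u z lam h y p hy hp => ?_⟩
  obtain ⟨Y, hY⟩ := hP.exists_isControlToState (by omega) hΩ_bdd
  obtain ⟨δ, hδ⟩ := h.exists_gradF_eq hY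
  have hsum := hB (‖z 0 - z'‖ + ‖lam 0 - lam'‖) (P.α / 2) (by linarith [hP.α_pos]) _ _ _ _
    (h.errorRecursion hP hY hσ hK hδ) (le_add_of_nonneg_right (norm_nonneg _))
    (le_add_of_nonneg_left (norm_nonneg _))
  have e : ∀ k, u k - u' - (z k - z') = u k - z k := fun k => by rw [hK.u_eq_z]; abel
  simp only [e, sub_sub_sub_cancel_right] at hsum
  have hα := hP.α_pos
  have hs := summable_of_sum_range_le (fun k => by positivity) hsum
  obtain ⟨hu, hz, hl⟩ := hY.tendsto_errors hP hε_sum.tendsto_atTop_zero hK hδ hs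
  have hR := h.R_le hP hY hσ hτ hδ
  have hρ : ∀ k, 0 ≤ κ * (ε k ^ 2 + ‖u (k + 1) - z (k + 1)‖ ^ 2 + ‖z (k + 1) - z k‖ ^ 2) :=
    fun k => by positivity
  have hρsum : ∀ N, ∑ k ∈ Finset.range N,
      κ * (ε k ^ 2 + ‖u (k + 1) - z (k + 1)‖ ^ 2 + ‖z (k + 1) - z k‖ ^ 2) ≤
      κ * (∑' k, ε k ^ 2 + B (‖z 0 - z'‖ + ‖lam 0 - lam'‖)) := by
    intro N
    rw [← Finset.mul_sum]
    refine mul_le_mul_of_nonneg_left ?_ hκ0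
    refine le_trans ?_ (add_le_add (hε_sq.sum_le_tsum (Finset.range N)
      fun k _ => sq_nonneg _) (hsum N))
    rw [← Finset.sum_add_distrib]
    refine Finset.sum_le_sum fun k _ => ?_
    have : 0 ≤ P.α / 2 * ‖u (k + 2) - u'‖ ^ 2 := by positivity
    linarith
  have hyt : Tendsto (fun k => y k - y') atTop (𝓝 0) := by
    have := (Y.continuous.tendsto 0).comp hu
    rw [map_zero] at this
    refine this.congr fun k => ?_
    rw [hy, hK.state_eq, hY.state_eq, hY.state_eq, ← map_sub, add_sub_add_right_eq_sub,
      Function.comp_apply]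
  have hpt : Tendsto (fun k => p k - p') atTop (𝓝 0) := by
    have := ((Y.comp toL2).continuous.tendsto 0).comp hyt
    rw [map_zero] at this
    have := this.neg
    rw [neg_zero] at this
    refine this.congr fun k => ?_
    rw [hp, hK.adj_eq, hY.adjState_eq, hY.adjState_eq, ← map_sub, sub_sub_sub_cancel_left,
      Function.comp_apply, ContinuousLinearMap.comp_apply, ← map_neg, ← map_neg, neg_sub, map_sub]
  refine ⟨?_, ?_, fun k hk => inf_Icc_le_of_sum_le hR hρsum hk,
    tendsto_mul_inf_Icc_of_summable hR hρ (summable_of_sum_range_le hρ hρsum)⟩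
  · simpa using (hu.norm.add hz.norm).add hl.norm
  · simpa using hyt.norm.add hpt.norm
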